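/- **Setting.** Let $(\Omega,\mathcal F_T,(\mathcal F_t)_{t\in[0,T]},P)$ be a filtered probability space and $S$ an $\mathbb R^d$-valued semimartingale on $[0,T]$. Let $U:\mathbb R\to[-\infty,\infty)$ be proper, concave, non-decreasing and upper semicontinuous, with $U(0)=0$ and $\inf\{x:U(x)>-\infty\}<0<\inf\{x:U(x)=U(\infty)\}$, where $U(\infty)=\lim_{x\to\infty}U(x)$ and $\inf\emptyset=\infty$. Put $$\hat U(x)=-U(-|x|),\qquad V(y)=\sup_{x\in\mathbb R}\{U(x)-xy\},\qquad \hat V(y)=\sup_{x\in\mathbb R}\{xy-\hat U(x)\}.$$ For $\Phi\in\{\hat U,\hat V\}$ let $L^{\Phi}$ be the Orlicz space of ($P$-a.s. classes of) random variables $X$ with $E[\Phi(\lambda X)]<\infty$ for some $\lambda>0$, let $L^\Phi_+$ be its cone of a.s. non-negative elements, and equip $L^{\hat U}$ with the gauge norm $\|X\|_{\hat U}=\inf\{\lambda>0: E[\hat U(X/\lambda)]\le 1\}$. Write $I_f(X)=E[f(X)]$ and let $\mathcal D=\{X\in L^{\hat U}: I_U(X)>-\infty\}$. Let $\operatorname{core}\mathcal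 D$ be the algebraic interior of $\mathcal D$ in $L^{\hat U}$; equivalently, $\operatorname{core}\mathcal D=\{X\in L^{\hat U}:\exists\lambda>1,\ I_U(\lambda X)>-\infty\}$. Let $L(S)$ be the set of predictable $S$-integrable processes, $H\cdot S_t=\int_{(0,t]}H\,dS$, and $$\mathcal K=\Big\{H\cdot S_T: H\in L(S),\ \inf_{t\in[0,T]}H\cdot S_t\in L^{\hat U}\Big\},\qquad \mathcal C=(\mathcal K-L^0_+)\cap L^{\hat U},$$ where $L^0_+$ is the set of a.s. non-negative random variables. Let $\operatorname{cl}^{\star}$ denote the norm closure in $L^{\hat U}$, and $\operatorname{cl}^{\circledast}$ the closure in $L^{\hat U}$ for the weak topology $\sigma(L^{\hat U},L^{\hat V})$ of the pairing $\langle X,Y\rangle=E[XY]$. For $\mathcal G\subseteq L^{\hat U}$ and $Y\in L^{\hat V}$ put $\delta^{\circledast}_{\mathcal G}(Y)=\sup_{X\in\mathcal G}E[XY]$. **Theorem 2.1.** Let $B\in L^{\hat U}$ satisfy $(B+\mathcal C)\cap\operatorname{core}\mathcal D\neq\emptyset$, and set $\mathcal A=B+\mathcal C$. Then, in $[-\infty,\infty]$,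 $$\sup_{X\in\mathcal A}I_U(X)=\sup_{X\in\operatorname{cl}^{\star}\mathcal A}I_U(X)=\sup_{X\in\mathcal A\cap\mathcal D}I_U(X)=\sup_{X\in\operatorname{cl}^{\circledast}(\mathcal A\cap\mathcal D)}I_U(X)=\min_{Y\in L^{\hat V}_+}\big\{I_V(Y)+\delta^{\circledast}_{\mathcal A\cap\mathcal D}(Y)\big\},$$ and the minimum is attained. -/

import Mathlib

open MeasureTheory Set Filter Topology
open scoped NNReal ENNReal

noncomputable section

namespace ExpUtility

/-! ### Utility functions and conjugates -/

/-- A utility function: `U : ℝ → [-∞, ∞)` proper, concave (its hypograph is convex),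
non-decreasing and upper semicontinuous. -/
structure IsUtility (U : ℝ → EReal) : Prop where
  lt_top : ∀ x, U x ≠ ⊤
  dom_nonempty : ∃ x, U x ≠ ⊥
  concave : Convex ℝ {p : ℝ × ℝ | (p.2 : EReal) ≤ U p.1}
  mono : Monotone U
  usc : UpperSemicontinuous U

/-- The lower bound of the effective domain `dom U = {x | U x > -∞}`. -/
def domInf (U : ℝ → EReal) : EReal := sInf ((fun x : ℝ => (x : EReal)) '' {x | ⊥ < U x})

/-- The bliss point `inf {x | U x = U(∞)}`; for a non-decreasing `U` the limit `U(∞)` is the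
supremum of `U`. -/
def blissPoint (U : ℝ → EReal) : EReal :=
  sInf ((fun x : ℝ => (x : EReal)) '' {x | U x = ⨆ z, U z})

/-- The normalization of the initial endowment to `0`. -/
structure IsNormalized (U : ℝ → EReal) : Prop where
  domInf_neg : domInf U < 0
  bliss_pos : 0 < blissPoint U
  zero : U 0 = 0

/-- The Young function `Û(x) = -U(-|x|)` given by the left tail of `U`. -/
def young (U : ℝ → EReal) (x : ℝ) : EReal := -U (-|x|)

/-- The convex conjugate `Φ*(y) = sup_x (x y - Φ x)`. -/
def convexConj (Φ : ℝ → EReal) (y : ℝ) : EReal := ⨆ x : ℝ, (((x * y : ℝ) : EReal) - Φ x)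

/-- The concave conjugate `U*(y) = inf_x (x y - U x)`. -/
def concaveConj (U : ℝ → EReal) (y : ℝ) : EReal := ⨅ x : ℝ, (((x * y : ℝ) : EReal) - U x)

/-- `V = -U*`. -/
def dualUtility (U : ℝ → EReal) (y : ℝ) : EReal := -concaveConj U y

/-- The conjugate Young function `V̂ = Û*`. -/
def conjYoung (U : ℝ → EReal) : ℝ → EReal := convexConj (young U)

/-! ### Expectations, Orlicz spaces, dualities

Random variables are functions `Ω → ℝ`; every notion below is invariant under almost sure
equality. -/

section Orlicz

variable {Ω : Type*} [MeasurableSpace Ω] (P : Measure Ω)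

/-- Expectation of an extended-real random variable, `E[f⁺] - E[f⁻]`. -/
def expect (f : Ω → EReal) : EReal :=
  ((∫⁻ ω, (f ω).toENNReal ∂P : ℝ≥0∞) : EReal) - ((∫⁻ ω, (-f ω).toENNReal ∂P : ℝ≥0∞) : EReal)

/-- The integral functional `I_f(X) = E[f(X)]`. -/
def integralFunctional (f : ℝ → EReal) (X : Ω → ℝ) : EReal := expect P (fun ω => f (X ω))

/-- The Orlicz space `L^Φ`. -/
def orlicz (Φ : ℝ → EReal) : Set (Ω → ℝ) :=
  {X | AEStronglyMeasurable X P ∧ ∃ r : ℝ, 0 < r ∧ expect P (fun ω => Φ (r * X ω)) < ⊤}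

/-- The positive cone `L^Φ_+`. -/
def orliczPos (Φ : ℝ → EReal) : Set (Ω → ℝ) := {X | X ∈ orlicz P Φ ∧ 0 ≤ᵐ[P] X}

/-- The Minkowski gauge norm `‖X‖_Φ`. -/
def gaugeNorm (Φ : ℝ → EReal) (X : Ω → ℝ) : ℝ :=
  sInf {r : ℝ | 0 < r ∧ expect P (fun ω => Φ (X ω / r)) ≤ 1}

/-- The closure of `G` in `L^Φ` for the gauge norm. -/
def normClosure (Φ : ℝ → EReal) (G : Set (Ω → ℝ)) : Set (Ω → ℝ) :=
  {X | X ∈ orlicz P Φ ∧ ∀ ε : ℝ, 0 < ε → ∃ Z ∈ G, gaugeNorm P Φ (fun ω => X ω - Z ω) < ε}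

/-- The closure of `G` in `L^Φ` for the weak topology `σ(L^Φ, L^Ψ)` of the pairing
`⟨X, Y⟩ = E[XY]`: every basic weak neighbourhood of a closure point meets `G`. -/
def weakClosure (Φ Ψ : ℝ → EReal) (G : Set (Ω → ℝ)) : Set (Ω → ℝ) :=
  {X | X ∈ orlicz P Φ ∧
    ∀ (n : ℕ) (Y : Fin n → Ω → ℝ), (∀ i, Y i ∈ orlicz P Ψ) → ∀ ε : ℝ, 0 < ε →
      ∃ Z ∈ G, ∀ i, |(∫ ω, X ω * Y i ω ∂P) - ∫ ω, Z ω * Y i ω ∂P| < ε}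

/-- The support function `δ_G(Y) = sup_{X ∈ G} E[XY]`. -/
def supportFun (G : Set (Ω → ℝ)) (Y : Ω → ℝ) : EReal :=
  ⨆ X ∈ G, ((∫ ω, X ω * Y ω ∂P : ℝ) : EReal)

/-- The effective domain `𝒟 = dom I_U` of expected utility in `L^Û`. -/
def utilDom (U : ℝ → EReal) : Set (Ω → ℝ) :=
  {X | X ∈ orlicz P (young U) ∧ ⊥ < integralFunctional P U X}

/-- The algebraic interior of a subset of `L^Φ`, relative to `L^Φ`. -/
def algCore (Φ : ℝ → EReal) (G : Set (Ω → ℝ)) : Set (Ω → ℝ) :=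
  {X | X ∈ orlicz P Φ ∧ ∀ Z ∈ orlicz P Φ, ∃ ε : ℝ, 0 < ε ∧
    ∀ r : ℝ, 0 ≤ r → r ≤ ε → (fun ω => X ω + r * Z ω) ∈ G}

end Orlicz

/-! ### Stochastic integration with respect to a semimartingale on `[0, T]` -/

/-- The path `f` is càdlàg on `[0, T]`. -/
def IsCadlagOn {E : Type*} [TopologicalSpace E] (T : ℝ≥0) (f : ℝ≥0 → E) : Prop :=
  (∀ t, t < T → ContinuousWithinAt f (Ioi t) t) ∧
  (∀ t, 0 < t → t ≤ T → ∃ l : E, Tendsto f (𝓝[<] t) (𝓝 l))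

/-- An elementary predictable integrand `∑ᵢ ξᵢ 1_{(sᵢ, tᵢ]}` with `ξᵢ` bounded and
`ℱ_{sᵢ}`-measurable. -/
structure ElemIntegrand {Ω : Type*} {mΩ : MeasurableSpace Ω} (ℱ : Filtration ℝ≥0 mΩ)
    (E : Type*) [NormedAddCommGroup E] where
  n : ℕ
  s : Fin n → ℝ≥0
  t : Fin n → ℝ≥0
  ξ : Fin n → Ω → E
  le : ∀ i, s i ≤ t i
  meas : ∀ i, StronglyMeasurable[ℱ (s i)] (ξ i)
  bdd : ∃ c : ℝ, ∀ i ω, ‖ξ i ω‖ ≤ c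

section Integral

variable {Ω : Type*} {mΩ : MeasurableSpace Ω} {ℱ : Filtration ℝ≥0 mΩ}
  {E : Type*} [NormedAddCommGroup E] [InnerProductSpace ℝ E]

/-- The integrand as a process. -/
def ElemIntegrand.eval (H : ElemIntegrand ℱ E) (u : ℝ≥0) (ω : Ω) : E :=
  ∑ i, (Ioc (H.s i) (H.t i)).indicator (fun _ => H.ξ i ω) u

/-- The elementary integral `(H · X)_u = ∑ᵢ ⟨ξᵢ, X_{tᵢ ∧ u} - X_{sᵢ ∧ u}⟩`. -/
def ElemIntegrand.integral (H : ElemIntegrand ℱ E) (X : ℝ≥0 → Ω → E) (u : ℝ≥0) (ω : Ω) : ℝ :=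
  ∑ i, inner ℝ (H.ξ i ω) (X (min (H.t i) u) ω - X (min (H.s i) u) ω)

variable (P : Measure Ω) (ℱ) (T : ℝ≥0)

/-- `S` is a semimartingale on `[0, T]`: an adapted càdlàg process which is a good integrator,
that is, the elementary integrals `(H · S)_T` with `‖H‖ ≤ 1` are bounded in probability. By the
Bichteler–Dellacherie theorem this is the same as being the sum of a local martingale and an
adapted càdlàg process of finite variation. -/
structure IsSemimartingale (S : ℝ≥0 → Ω → E) : Prop where
  adapted : ∀ t ≤ T, StronglyMeasurable[ℱ t] (S t)
  cadlag : ∀ᵐ ω ∂P, IsCadlagOn T (fun t => S t ω)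
  good_integrator : ∀ ε : ℝ≥0∞, 0 < ε → ∃ c : ℝ, ∀ H : ElemIntegrand ℱ E,
    (∀ u ω, ‖H.eval u ω‖ ≤ 1) → P {ω | c < |H.integral S T ω|} ≤ ε

/-- The size of a real process in the semimartingale (Émery) topology on `[0, T]`:
`sup_{|K| ≤ 1} E[sup_{u ≤ T} 1 ∧ |(K · Z)_u|]`, `K` elementary predictable. -/
def emerySize (Z : ℝ≥0 → Ω → ℝ) : ℝ≥0∞ :=
  ⨆ K : ElemIntegrand ℱ ℝ, ⨆ _ : ∀ u ω, |K.eval u ω| ≤ 1,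
    ∫⁻ ω, ⨆ u ∈ Icc (0 : ℝ≥0) T, min 1 (ENNReal.ofReal |K.integral Z u ω|) ∂P

/-- `IsStochIntegral P ℱ T S H X`: the process `H` is in `L(S)`, i.e. predictable and
`S`-integrable on `(0, T]`, and `X` is (a version of) the stochastic integral
`H · S = ∫_{(0,·]} H dS`.

The graph of the stochastic integral of a semimartingale is the smallest relation that contains
the elementary integrals and is closed under limits in which the integrands converge pointwise
and the integrals converge in the semimartingale topology. Indeed, bounded predictable integrands
are reached by dominated convergence and the monotone class theorem; a general `H ∈ L(S)` is
reached because, by definition of `L(S)`, the integrals of the truncations `H 1_{‖H‖ ≤ n}`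
converge in the semimartingale topology to `H · S`. Conversely the space of stochastic integrals
is closed in the semimartingale topology (Mémin), and a limit of integrals whose integrands
converge pointwise is the integral of the pointwise limit. -/
inductive IsStochIntegral (S : ℝ≥0 → Ω → E) : (ℝ≥0 → Ω → E) → (ℝ≥0 → Ω → ℝ) → Prop
  | elem (H : ElemIntegrand ℱ E) : IsStochIntegral S H.eval (H.integral S)
  | lim (Hs : ℕ → ℝ≥0 → Ω → E) (Xs : ℕ → ℝ≥0 → Ω → ℝ) (H : ℝ≥0 → Ω → E) (X : ℝ≥0 → Ω → ℝ)
      (integral : ∀ n, IsStochIntegral S (Hs n) (Xs n))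
      (pointwise : ∀ t, 0 < t → t ≤ T → ∀ ω, Tendsto (fun n => Hs n t ω) atTop (𝓝 (H t ω)))
      (meas : ∀ t ≤ T, AEStronglyMeasurable (X t) P)
      (cadlag : ∀ᵐ ω ∂P, IsCadlagOn T (fun t => X t ω))
      (zero : ∀ᵐ ω ∂P, X 0 ω = 0)
      (emery : Tendsto (fun n => emerySize ℱ P T (fun t ω => Xs n t ω - X t ω)) atTop (𝓝 0)) :
      IsStochIntegral S H X

/-- The cone `𝒦 = {H · S_T | H ∈ 𝒯}` of tame terminal wealths with zero initial capital. The
integrand `H ∈ L(S)` is tame, `H ∈ 𝒯`, if `inf_{t ∈ [0,T]} (H · S)_t` belongs to `L^Û`. -/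
def tameWealths (S : ℝ≥0 → Ω → E) (U : ℝ → EReal) : Set (Ω → ℝ) :=
  {k | ∃ (H : ℝ≥0 → Ω → E) (X : ℝ≥0 → Ω → ℝ), IsStochIntegral ℱ P T S H X ∧
    (fun ω => ⨅ t : Icc (0 : ℝ≥0) T, X t ω) ∈ orlicz P (young U) ∧ k = X T}

/-- The cone `𝒞 = (𝒦 - L⁰₊) ∩ L^Û` of wealths that are super-replicable with zero initial
capital. -/
def superRep (S : ℝ≥0 → Ω → E) (U : ℝ → EReal) : Set (Ω → ℝ) :=
  {X | X ∈ orlicz P (young U) ∧ ∃ k ∈ tameWealths ℱ P T S U, ∃ l : Ω → ℝ,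
    AEStronglyMeasurable l P ∧ 0 ≤ᵐ[P] l ∧ X =ᵐ[P] k - l}

/-- `𝒜 = B + 𝒞`. -/
def endowed (S : ℝ≥0 → Ω → E) (U : ℝ → EReal) (B : Ω → ℝ) : Set (Ω → ℝ) :=
  (fun X => B + X) '' superRep ℱ P T S U

end Integral

end ExpUtility

end

/-!
Both the primal and the dual side only see that `𝒜 = B + 𝒞` is a convex subset of `L^Û` that meets
the core of `𝒟`; `duality_of_convex` proves the theorem for every such set.

*Convexity.* The graph of the stochastic integral is stable under linear combinations
(`IsStochIntegral.linearComb`, by induction on the construction of both integrals). A running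
infimum of a combination lies between the combination of the running infima and `0`, so tame
wealths form a convex set (`convex_tameWealths`). Measurability of the running infimum and its
finiteness come from the càdlàg property of the paths.

*Expectations.* An extended-real expectation is the supremum of the integrals of integrable
minorants (`exists_integrable_le_of_lt_expect`), which turns every concavity or duality inequality
for `I_U` into a pointwise inequality between real functions.

*Strong duality.* Let the primal value `u` be finite. Since `𝒜` meets the core of `𝒟`, algebraic
Hahn–Banach separation gives a linear functional `q` with `I_U(Z) ≤ u + q(Z - X)` for `X ∈ 𝒜` and
`Z ∈ L^Û` (`exists_supergradient`), and `q` is positive as `U` is non-decreasing. Restricted to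
indicators, `q` is a finitely additive measure; the outer measure it generates is a countably
additive measure `μ ≤ q`, and `q - μ` is arbitrarily small on sets of probability arbitrarily close
to one (`IsPositiveOn.exists_regularPart`). The competitor `Z` in the supergradient inequality may
be changed to `X` off such a set, so that only `μ` acts on `Z - X`; hence the inequality
`E[U(z)] ≤ u + ∫ (z - X) dμ` for bounded `z` and `X ∈ 𝒜 ∩ 𝒟`
(`integral_utility_le_of_regularPart`). This step is where `𝒜 ∩ 𝒟` replaces `𝒜` in the dual problem.
With `Y = dμ/dP` and `z` running through approximate maximizers of `U(z) - z Y`, monotone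
convergence gives `I_V(Y) + E[XY] ≤ u` (`exists_dual_bound`).

*Closures.* Weak duality holds on the weak closure of `𝒜 ∩ 𝒟`, since support functions do not
change there. For the norm closure, a convex combination with a point of the core absorbs the
approximation error (`integralFunctional_le_of_mem_normClosure`).
-/

noncomputable section

namespace ExpUtility

/-! ### Expectation of extended-real random variables -/

section Expectation

variable {Ω : Type*} [MeasurableSpace Ω] {P : Measure Ω}

lemma expect_mono {f g : Ω → EReal} (h : ∀ᵐ ω ∂P, f ω ≤ g ω) : expect P f ≤ expect P g := by
  refine EReal.sub_le_sub ?_ ?_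
  · exact EReal.coe_ennreal_le_coe_ennreal_iff.2
      (lintegral_mono_ae (h.mono fun ω hω => EReal.toENNReal_le_toENNReal hω))
  · exact EReal.coe_ennreal_le_coe_ennreal_iff.2
      (lintegral_mono_ae (h.mono fun ω hω =>
        EReal.toENNReal_le_toENNReal (EReal.neg_le_neg_iff.2 hω)))

lemma expect_of_nonneg {f : Ω → EReal} (h : ∀ ω, 0 ≤ f ω) :
    expect P f = ((∫⁻ ω, (f ω).toENNReal ∂P : ℝ≥0∞) : EReal) := by
  have h0 : ∀ ω, (-f ω).toENNReal = 0 := fun ω =>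
    EReal.toENNReal_of_nonpos (by simpa using EReal.neg_le_neg_iff.2 (h ω))
  simp [expect, h0]

lemma expect_coe {g : Ω → ℝ} (hg : Integrable g P) :
    expect P (fun ω => (g ω : EReal)) = ((∫ ω, g ω ∂P : ℝ) : EReal) := by
  have h1 : ∫⁻ ω, ENNReal.ofReal (g ω) ∂P ≠ ⊤ := hg.lintegral_lt_top.ne
  have h2 : ∫⁻ ω, ENNReal.ofReal (-g ω) ∂P ≠ ⊤ := hg.neg.lintegral_lt_top.ne
  rw [integral_eq_lintegral_pos_part_sub_lintegral_neg_part hg, EReal.coe_sub,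
    EReal.coe_ennreal_toReal h1, EReal.coe_ennreal_toReal h2]
  rfl

lemma integral_le_expect {f : Ω → EReal} {g : Ω → ℝ} (hg : Integrable g P)
    (h : ∀ᵐ ω ∂P, (g ω : EReal) ≤ f ω) : ((∫ ω, g ω ∂P : ℝ) : EReal) ≤ expect P f :=
  (expect_coe hg).symm.trans_le (expect_mono h)

/-- An expectation is the supremum of the integrals of integrable minorants. This reduces
inequalities between extended-real expectations to linear statements on integrable functions. -/
lemma exists_integrable_le_of_lt_expect {f : Ω → EReal} [IsFiniteMeasure P]
    (hf : AEMeasurable f P) {c : ℝ}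
    (hc : (c : EReal) < expect P f) :
    ∃ g : Ω → ℝ, Integrable g P ∧ (∀ᵐ ω ∂P, (g ω : EReal) ≤ f ω) ∧ c < ∫ ω, g ω ∂P := by
  have hm : AEMeasurable (fun ω => (-f ω).toENNReal) P := by
    have h1 : Measurable (fun x : EReal => (-x).toENNReal) := by fun_prop
    exact h1.comp_aemeasurable hf
  have hfin : ∫⁻ ω, (-f ω).toENNReal ∂P ≠ ⊤ := by
    intro h
    simp [expect, h] at hc
  have hae := ae_lt_top' hm hfin
  have hint : Integrable (fun ω => ((-f ω).toENNReal).toReal) P :=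
    integrable_toReal_of_lintegral_ne_top hm hfin
  have hval : ∫ ω, ((-f ω).toENNReal).toReal ∂P = (∫⁻ ω, (-f ω).toENNReal ∂P).toReal :=
    integral_toReal hm hae
  set b := ∫⁻ ω, (-f ω).toENNReal ∂P with hb
  obtain ⟨φ, hφ, hlt⟩ : ∃ φ : SimpleFunc Ω ℝ≥0, (∀ ω, (φ ω : ℝ≥0∞) ≤ (f ω).toENNReal) ∧
      ((c + b.toReal : ℝ) : EReal) < ((∫⁻ ω, φ ω ∂P : ℝ≥0∞) : EReal) := by
    have h1 : ((c + b.toReal : ℝ) : EReal) < ((∫⁻ ω, (f ω).toENNReal ∂P : ℝ≥0∞) : EReal) := by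
      have : (b : EReal) = ((b.toReal : ℝ) : EReal) := (EReal.coe_ennreal_toReal hfin).symm
      unfold expect at hc
      rw [← hb, this] at hc
      rw [EReal.coe_add]
      exact EReal.add_lt_of_lt_sub hc
    by_contra! hcon
    refine absurd h1 (not_lt.2 ?_)
    rcases lt_or_ge (c + b.toReal) 0 with hneg | hpos
    · exact absurd (hcon 0 (by simp)) (not_le.2 (lt_of_lt_of_le (b := (0 : EReal))
        (by exact_mod_cast hneg) (EReal.coe_ennreal_nonneg _)))
    · have h2 : ((c + b.toReal : ℝ) : EReal) = ((ENNReal.ofReal (c + b.toReal) : ℝ≥0∞) : EReal) := by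
        rw [EReal.coe_ennreal_ofReal, max_eq_left hpos]
      rw [h2, EReal.coe_ennreal_le_coe_ennreal_iff, lintegral_eq_nnreal]
      refine iSup₂_le fun φ hφ => ?_
      have := hcon φ hφ
      rw [h2, EReal.coe_ennreal_le_coe_ennreal_iff] at this
      rw [← SimpleFunc.lintegral_eq_lintegral]
      simpa using this
  have hφi : Integrable (fun ω => ((φ ω : ℝ≥0) : ℝ)) P := by
    have := (φ.map ((↑) : ℝ≥0 → ℝ)).integrable_of_isFiniteMeasure (μ := P)
    exact this
  refine ⟨fun ω => φ ω - ((-f ω).toENNReal).toReal, hφi.sub hint, ?_, ?_⟩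
  · filter_upwards [hae] with ω hω
    rcases le_total 0 (f ω) with h | h
    · have h0 : (-f ω).toENNReal = 0 :=
        EReal.toENNReal_of_nonpos (by simpa using EReal.neg_le_neg_iff.2 h)
      simp only [h0, ENNReal.toReal_zero, sub_zero]
      have := EReal.coe_ennreal_le_coe_ennreal_iff.2 (hφ ω)
      rw [EReal.coe_toENNReal h] at this
      exact this
    · have h0 : φ ω = 0 := by
        have := hφ ω
        rw [EReal.toENNReal_of_nonpos h] at this
        simpa using this
      have h1 : 0 ≤ -f ω := by simpa using EReal.neg_le_neg_iff.2 h
      have h2 : -f ω ≠ ⊤ := by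
        intro h2
        simp [h2] at hω
      rw [h0, EReal.toReal_toENNReal h1]
      have h3 : -f ω ≠ ⊥ := fun h3 => by simp [h3] at h1
      have h4 : ((-f ω).toReal : EReal) = -f ω := EReal.coe_toReal h2 h3
      rw [EReal.coe_sub, h4]
      simp
  · rw [integral_sub hφi hint, hval]
    have h1 : ∫⁻ ω, φ ω ∂P ≠ ⊤ := by
      have := hφi.lintegral_lt_top.ne
      simpa using this
    rw [← EReal.coe_ennreal_toReal h1, EReal.coe_lt_coe_iff] at hlt
    have h2 : ∫ ω, ((φ ω : ℝ≥0) : ℝ) ∂P = (∫⁻ ω, φ ω ∂P).toReal := by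
      have := integral_toReal (μ := P) (f := fun ω => ((φ ω : ℝ≥0) : ℝ≥0∞))
        (by fun_prop) (by simp)
      simpa using this
    rw [h2]
    linarith

end Expectation

/-! ### Utility functions, Young functions and the Orlicz space as a vector space -/

section Utility

variable {U : ℝ → EReal}

lemma IsUtility.measurable (hU : IsUtility U) : Measurable U := hU.mono.measurable

lemma IsUtility.coe_le_of_convexComb (hU : IsUtility U) {a b x y s t : ℝ}
    (ha : (a : EReal) ≤ U x) (hb : (b : EReal) ≤ U y) (hs : 0 ≤ s) (ht : 0 ≤ t) (hst : s + t = 1) :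
    ((s * a + t * b : ℝ) : EReal) ≤ U (s * x + t * y) := by
  have := hU.concave (x := (x, a)) ha (y := (y, b)) hb hs ht hst
  simpa using this

lemma IsUtility.coe_toReal (hU : IsUtility U) {x : ℝ} (h : U x ≠ ⊥) :
    ((U x).toReal : EReal) = U x := EReal.coe_toReal (hU.lt_top x) h

lemma young_nonneg (hU : IsUtility U) (h0 : U 0 = 0) (x : ℝ) : 0 ≤ young U x := by
  have : U (-|x|) ≤ U 0 := hU.mono (by simp)
  rw [h0] at this
  simpa [young] using EReal.neg_le_neg_iff.2 this

lemma young_mono (hU : IsUtility U) {x y : ℝ} (h : |x| ≤ |y|) : young U x ≤ young U y :=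
  EReal.neg_le_neg_iff.2 (hU.mono (by linarith))

lemma measurable_young (hU : IsUtility U) : Measurable (young U) := by
  have := hU.measurable
  unfold young
  fun_prop

/-- Convexity of the Young function along rays. -/
lemma toENNReal_young_mul_le (hU : IsUtility U) (h0 : U 0 = 0) {t : ℝ} (ht : 0 < t) (ht1 : t ≤ 1)
    (x : ℝ) : (young U (t * x)).toENNReal ≤ ENNReal.ofReal t * (young U x).toENNReal := by
  by_cases hx : U (-|x|) = ⊥
  · have : young U x = ⊤ := by simp [young, hx]
    rw [this, EReal.toENNReal_top, ENNReal.mul_top (by simpa using ht)]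
    exact le_top
  · have h1 := hU.coe_toReal hx
    set b := (U (-|x|)).toReal
    have h2 := hU.coe_le_of_convexComb (t := 1 - t) h1.le (b := 0) (y := 0) (by simp [h0]) ht.le
      (by linarith) (by ring)
    have h3 : t * -|x| + (1 - t) * 0 = -|t * x| := by
      rw [abs_mul, abs_of_pos ht]; ring
    rw [h3] at h2
    have h4 : young U x = ((-b : ℝ) : EReal) := by rw [young, ← h1, EReal.coe_neg]
    have h5 : young U (t * x) ≤ ((t * -b : ℝ) : EReal) := by
      have := EReal.neg_le_neg_iff.2 h2
      rw [← EReal.coe_neg] at this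
      refine this.trans (le_of_eq ?_)
      congr 1; ring
    rw [h4, EReal.real_coe_toENNReal, ← ENNReal.ofReal_mul ht.le, ← EReal.real_coe_toENNReal]
    exact EReal.toENNReal_le_toENNReal h5

variable {Ω : Type*} [MeasurableSpace Ω] {P : Measure Ω}

lemma mem_orlicz_young (hU : IsUtility U) (h0 : U 0 = 0) {X : Ω → ℝ} :
    X ∈ orlicz P (young U) ↔ AEStronglyMeasurable X P ∧
      ∃ r : ℝ, 0 < r ∧ ∫⁻ ω, (young U (r * X ω)).toENNReal ∂P < ⊤ := by
  simp only [orlicz, mem_ofPred_eq, expect_of_nonneg fun ω => young_nonneg hU h0 _]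
  simp [lt_top_iff_ne_top]

lemma mem_orlicz_of_abs_le (hU : IsUtility U) (h0 : U 0 = 0) {X Z : Ω → ℝ}
    (hX : X ∈ orlicz P (young U)) (hZ : AEStronglyMeasurable Z P) (h : ∀ᵐ ω ∂P, |Z ω| ≤ |X ω|) :
    Z ∈ orlicz P (young U) := by
  rw [mem_orlicz_young hU h0] at hX ⊢
  obtain ⟨-, r, hr, hlt⟩ := hX
  refine ⟨hZ, r, hr, (lintegral_mono_ae ?_).trans_lt hlt⟩
  filter_upwards [h] with ω hω
  refine EReal.toENNReal_le_toENNReal (young_mono hU ?_)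
  rw [abs_mul, abs_mul]
  gcongr

lemma aemeasurable_young (hU : IsUtility U) {X : Ω → ℝ} (hX : AEStronglyMeasurable X P) (r : ℝ) :
    AEMeasurable (fun ω => (young U (r * X ω)).toENNReal) P := by
  have h1 := measurable_young hU
  have h2 : Measurable (fun x : ℝ => (young U (r * x)).toENNReal) := by fun_prop
  exact h2.comp_aemeasurable hX.aemeasurable

lemma add_mem_orlicz (hU : IsUtility U) (h0 : U 0 = 0) {X Z : Ω → ℝ}
    (hX : X ∈ orlicz P (young U)) (hZ : Z ∈ orlicz P (young U)) :
    X + Z ∈ orlicz P (young U) := by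
  rw [mem_orlicz_young hU h0] at hX hZ ⊢
  obtain ⟨hXm, r, hr, hX⟩ := hX
  obtain ⟨hZm, s, hs, hZ⟩ := hZ
  refine ⟨hXm.add hZm, min r s / 2, by positivity, ?_⟩
  calc ∫⁻ ω, (young U (min r s / 2 * (X + Z) ω)).toENNReal ∂P
      ≤ ∫⁻ ω, (young U (r * X ω)).toENNReal + (young U (s * Z ω)).toENNReal ∂P := by
        refine lintegral_mono fun ω => ?_
        have hm : 0 < min r s := by positivity
        have hx : min r s * |X ω| ≤ r * |X ω| := by gcongr; exact min_le_left _ _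
        have hz : min r s * |Z ω| ≤ s * |Z ω| := by gcongr; exact min_le_right _ _
        have habs : |min r s / 2 * (X + Z) ω| ≤ (r * |X ω| + s * |Z ω|) / 2 := by
          rw [abs_mul, abs_of_pos (by positivity), Pi.add_apply]
          nlinarith [abs_add_le (X ω) (Z ω)]
        rcases le_total (r * |X ω|) (s * |Z ω|) with h | h
        · refine (EReal.toENNReal_le_toENNReal (young_mono hU (y := s * Z ω) ?_)).trans
            le_add_self
          rw [abs_mul s, abs_of_pos hs]; linarith
        · refine (EReal.toENNReal_le_toENNReal (young_mono hU (y := r * X ω) ?_)).trans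
            le_self_add
          rw [abs_mul r, abs_of_pos hr]; linarith
    _ = ∫⁻ ω, (young U (r * X ω)).toENNReal ∂P + ∫⁻ ω, (young U (s * Z ω)).toENNReal ∂P :=
        lintegral_add_left' (aemeasurable_young hU hXm r) _
    _ < ⊤ := ENNReal.add_lt_top.2 ⟨hX, hZ⟩

lemma smul_mem_orlicz (hU : IsUtility U) (h0 : U 0 = 0) {X : Ω → ℝ} (c : ℝ)
    (hX : X ∈ orlicz P (young U)) : c • X ∈ orlicz P (young U) := by
  rw [mem_orlicz_young hU h0] at hX ⊢
  obtain ⟨hXm, r, hr, hX⟩ := hX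
  refine ⟨hXm.const_smul c, r / (|c| + 1), by positivity, (lintegral_mono fun ω => ?_).trans_lt hX⟩
  refine EReal.toENNReal_le_toENNReal (young_mono hU ?_)
  rw [Pi.smul_apply, smul_eq_mul, ← mul_assoc, abs_mul, abs_mul r]
  refine mul_le_mul_of_nonneg_right ?_ (abs_nonneg _)
  rw [abs_mul, abs_div, abs_of_pos hr, abs_of_pos (by positivity : 0 < |c| + 1), div_mul_eq_mul_div,
    div_le_iff₀ (by positivity)]
  nlinarith [abs_nonneg c]

/-- The Orlicz space `L^Û` as a space of functions; almost surely equal functions are not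
identified. -/
def orliczSpace (P : Measure Ω) (hU : IsUtility U) (h0 : U 0 = 0) : Submodule ℝ (Ω → ℝ) where
  carrier := orlicz P (young U)
  add_mem' := add_mem_orlicz hU h0
  zero_mem' := by
    rw [mem_orlicz_young hU h0]
    exact ⟨aestronglyMeasurable_const, 1, one_pos, by simp [young, h0]⟩
  smul_mem' c _ hX := smul_mem_orlicz hU h0 c hX

/-- Bounded random variables lie in `L^Û`, because `U` is finite somewhere to the left of `0`. -/
lemma bounded_mem_orlicz [IsFiniteMeasure P] (hU : IsUtility U) (hN : IsNormalized U) {X : Ω → ℝ}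
    (hX : AEStronglyMeasurable X P) {k : ℝ} (hk : ∀ᵐ ω ∂P, |X ω| ≤ k) :
    X ∈ orlicz P (young U) := by
  obtain ⟨_, ⟨x, hx, rfl⟩, hx0⟩ := sInf_lt_iff.1 hN.domInf_neg
  have hx0 : x < 0 := EReal.coe_neg'.1 hx0
  rw [mem_orlicz_young hU hN.zero]
  refine ⟨hX, -x / (|k| + 1), div_pos (by linarith) (by positivity), ?_⟩
  calc ∫⁻ ω, (young U (-x / (|k| + 1) * X ω)).toENNReal ∂P
      ≤ ∫⁻ ω, (young U x).toENNReal ∂P := by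
        refine lintegral_mono_ae ?_
        filter_upwards [hk] with ω hω
        refine EReal.toENNReal_le_toENNReal (young_mono hU ?_)
        rw [abs_mul, abs_div, abs_neg, abs_of_pos (by positivity : 0 < |k| + 1), div_mul_eq_mul_div,
          div_le_iff₀ (by positivity)]
        gcongr
        linarith [le_abs_self k]
    _ < ⊤ := by
        rw [lintegral_const]
        refine ENNReal.mul_lt_top ?_ (measure_lt_top _ _)
        rw [lt_top_iff_ne_top, EReal.toENNReal_ne_top_iff, young, abs_of_neg hx0, neg_neg, ne_eq,
          EReal.neg_eq_top_iff]
        exact hx.ne'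

lemma exists_lintegral_young_div_le_one (hU : IsUtility U) (h0 : U 0 = 0) {X : Ω → ℝ}
    (hX : X ∈ orlicz P (young U)) {ε : ℝ} (h : gaugeNorm P (young U) X < ε) :
    ∃ r : ℝ, 0 < r ∧ r < ε ∧ ∫⁻ ω, (young U (X ω / r)).toENNReal ∂P ≤ 1 := by
  have hne : {r : ℝ | 0 < r ∧ expect P (fun ω => young U (X ω / r)) ≤ 1}.Nonempty := by
    obtain ⟨hXm, s, hs, hX⟩ := (mem_orlicz_young hU h0).1 hX
    set b := ∫⁻ ω, (young U (s * X ω)).toENNReal ∂P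
    refine ⟨(b.toReal + 1) / s, by positivity, ?_⟩
    rw [expect_of_nonneg fun ω => young_nonneg hU h0 _]
    rw [← EReal.coe_ennreal_one, EReal.coe_ennreal_le_coe_ennreal_iff]
    calc ∫⁻ ω, (young U (X ω / ((b.toReal + 1) / s))).toENNReal ∂P
        ≤ ∫⁻ ω, ENNReal.ofReal (1 / (b.toReal + 1)) * (young U (s * X ω)).toENNReal ∂P := by
          refine lintegral_mono fun ω => ?_
          have hb : 0 ≤ b.toReal := ENNReal.toReal_nonneg
          have := toENNReal_young_mul_le hU h0 (t := 1 / (b.toReal + 1)) (by positivity)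
            (by rw [div_le_one (by positivity)]; linarith) (s * X ω)
          refine le_trans (le_of_eq ?_) this
          congr 2
          field_simp
      _ = ENNReal.ofReal (1 / (b.toReal + 1)) * b := lintegral_const_mul'' _ (aemeasurable_young hU hXm s)
      _ ≤ 1 := by
          rw [← ENNReal.ofReal_toReal hX.ne, ← ENNReal.ofReal_mul (by positivity), ← ENNReal.ofReal_one]
          refine ENNReal.ofReal_le_ofReal ?_
          have hb : 0 ≤ b.toReal := ENNReal.toReal_nonneg
          rw [ENNReal.ofReal_toReal hX.ne, div_mul_eq_mul_div, div_le_one (by positivity)]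
          linarith
  obtain ⟨r, ⟨hr, hr1⟩, hrε⟩ := exists_lt_of_csInf_lt hne h
  refine ⟨r, hr, hrε, ?_⟩
  rw [expect_of_nonneg fun ω => young_nonneg hU h0 _] at hr1
  exact_mod_cast hr1

lemma gaugeNorm_zero (h0 : U 0 = 0) : gaugeNorm P (young U) (fun _ : Ω => 0) = 0 := by
  have : {r : ℝ | 0 < r ∧ expect P (fun _ : Ω => young U (0 / r)) ≤ 1} = Ioi 0 := by
    ext r
    simp [young, h0, expect]
  rw [gaugeNorm, this, csInf_Ioi]

end Utility

/-! ### Càdlàg paths -/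

section Cadlag

lemma IsCadlagOn.linearComb {T : ℝ≥0} {f g : ℝ≥0 → ℝ} (hf : IsCadlagOn T f) (hg : IsCadlagOn T g)
    (a b : ℝ) : IsCadlagOn T (fun t => a * f t + b * g t) := by
  refine ⟨fun t ht => ((hf.1 t ht).const_mul a).add ((hg.1 t ht).const_mul b), fun t h0 ht => ?_⟩
  obtain ⟨l, hl⟩ := hf.2 t h0 ht
  obtain ⟨m, hm⟩ := hg.2 t h0 ht
  exact ⟨a * l + b * m, (hl.const_mul a).add (hm.const_mul b)⟩

lemma IsCadlagOn.comp_continuous {E F : Type*} [TopologicalSpace E] [TopologicalSpace F]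
    {T : ℝ≥0} {f : ℝ≥0 → E} (hf : IsCadlagOn T f) {φ : E → F} (hφ : Continuous φ) :
    IsCadlagOn T (fun t => φ (f t)) := by
  refine ⟨fun t ht => hφ.continuousAt.comp_continuousWithinAt (hf.1 t ht), fun t h0 ht => ?_⟩
  obtain ⟨l, hl⟩ := hf.2 t h0 ht
  exact ⟨φ l, (hφ.tendsto l).comp hl⟩

/-- A path stopped at time `a` is still càdlàg. -/
lemma IsCadlagOn.stopped {E : Type*} [TopologicalSpace E] {T : ℝ≥0} {f : ℝ≥0 → E}
    (hf : IsCadlagOn T f) (a : ℝ≥0) : IsCadlagOn T (fun t => f (min a t)) := by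
  refine ⟨fun t ht => ?_, fun t h0 ht => ?_⟩
  · rcases lt_or_ge t a with h | h
    · have h1 : (fun t => f (min a t)) =ᶠ[𝓝 t] f := by
        filter_upwards [Iio_mem_nhds h] with u hu
        rw [min_eq_right (le_of_lt hu)]
      exact (hf.1 t ht).congr_of_eventuallyEq (h1.filter_mono nhdsWithin_le_nhds) h1.eq_of_nhds
    · refine (continuousWithinAt_const (b := f a)).congr (fun u hu => ?_) ?_
      · rw [min_eq_left (h.trans (le_of_lt hu))]
      · rw [min_eq_left h]
  · rcases le_or_gt t a with h | h
    · obtain ⟨l, hl⟩ := hf.2 t h0 ht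
      refine ⟨l, hl.congr' ?_⟩
      filter_upwards [self_mem_nhdsWithin] with u hu
      rw [min_eq_right ((le_of_lt hu).trans h)]
    · refine ⟨f a, tendsto_const_nhds.congr' ?_⟩
      filter_upwards [mem_nhdsWithin_of_mem_nhds (Ioi_mem_nhds h)] with u hu
      rw [min_eq_left (le_of_lt hu)]

lemma IsCadlagOn.bddBelow {T : ℝ≥0} {f : ℝ≥0 → ℝ} (hf : IsCadlagOn T f) :
    BddBelow (f '' Icc 0 T) := by
  refine isCompact_Icc.induction_on (p := fun s => BddBelow (f '' s)) (by simp)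
    (fun s t hst ht => ht.mono (image_mono hst))
    (fun s t hs ht => by rw [image_union]; exact hs.union ht) ?_
  intro t ht
  have aux : ∀ {l : ℝ} {F : Filter ℝ≥0}, Tendsto f F (𝓝 l) → {u | l - 1 ≤ f u} ∈ F := fun h =>
    h (Ici_mem_nhds (by linarith))
  obtain ⟨c, hc⟩ : ∃ c, ∀ᶠ u in 𝓝[<] t, c ≤ f u := by
    rcases eq_zero_or_pos t with h | h
    · exact ⟨0, by simp [h]⟩
    · obtain ⟨l, hl⟩ := hf.2 t h ht.2
      exact ⟨_, aux hl⟩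
  obtain ⟨d, hd⟩ : ∃ d, ∀ᶠ u in 𝓝[>] t, u ≤ T → d ≤ f u := by
    rcases lt_or_ge t T with h | h
    · exact ⟨_, (show ∀ᶠ u in 𝓝[>] t, f t - 1 ≤ f u from aux (hf.1 t h)).mono fun u hu _ => hu⟩
    · refine ⟨0, ?_⟩
      filter_upwards [self_mem_nhdsWithin] with u hu hT
      exact absurd (lt_of_le_of_lt h hu) (not_lt.2 hT)
  refine ⟨{u | u ∈ Icc 0 T ∧ min (min c d) (f t) ≤ f u}, ?_, ⟨min (min c d) (f t), ?_⟩⟩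
  · have h1 : ∀ᶠ u in 𝓝 t, u ≤ T → min (min c d) (f t) ≤ f u := by
      rw [← nhdsNE_sup_pure, ← nhdsLT_sup_nhdsGT]
      simp only [eventually_sup, eventually_pure]
      refine ⟨⟨hc.mono fun u hu _ => ?_, hd.mono fun u hu hT => ?_⟩, fun _ => min_le_right _ _⟩
      · exact (min_le_left _ _).trans ((min_le_left _ _).trans hu)
      · exact (min_le_left _ _).trans ((min_le_right _ _).trans (hu hT))
    filter_upwards [self_mem_nhdsWithin, mem_nhdsWithin_of_mem_nhds h1] with u hu hu1
    exact ⟨hu, hu1 hu.2⟩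
  · rintro _ ⟨u, hu, rfl⟩
    exact hu.2

/-- By right continuity the infimum of a càdlàg path over `[0, T]` is the infimum over a countable
dense set of times together with `T`. -/
lemma IsCadlagOn.iInf_eq {T : ℝ≥0} {f : ℝ≥0 → ℝ} (hf : IsCadlagOn T f) :
    ⨅ t : Icc (0 : ℝ≥0) T, f t =
      ⨅ n : ℕ, f (min (TopologicalSpace.denseSeq ℝ≥0 n) T) ⊓ f T := by
  have hb := hf.bddBelow
  have hb1 : BddBelow (range fun t : Icc (0 : ℝ≥0) T => f t) := by
    rw [image_eq_range] at hb; exact hb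
  have hmem : ∀ u : ℝ≥0, min u T ∈ Icc (0 : ℝ≥0) T := fun u => ⟨zero_le, min_le_right _ _⟩
  have hT : T ∈ Icc (0 : ℝ≥0) T := ⟨zero_le, le_rfl⟩
  have : Nonempty (Icc (0 : ℝ≥0) T) := ⟨⟨T, hT⟩⟩
  refine le_antisymm ?_ ?_
  · exact le_ciInf fun n => le_inf (ciInf_le hb1 ⟨_, hmem _⟩) (ciInf_le hb1 ⟨T, hT⟩)
  · refine le_ciInf fun ⟨t, ht⟩ => ?_
    have hb2 : BddBelow (range fun n : ℕ => f (min (TopologicalSpace.denseSeq ℝ≥0 n) T) ⊓ f T) := by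
      obtain ⟨c, hc⟩ := hb
      refine ⟨c, ?_⟩
      rintro _ ⟨n, rfl⟩
      exact le_inf (hc ⟨_, hmem _, rfl⟩) (hc ⟨_, hT, rfl⟩)
    rcases eq_or_lt_of_le ht.2 with h | h
    · subst h
      exact (ciInf_le hb2 0).trans inf_le_right
    · by_contra! hcon
      obtain ⟨c, hc1, hc2⟩ := exists_between hcon
      have h1 : ∀ᶠ u in 𝓝[>] t, f u < c ∧ u < T :=
        ((hf.1 t h).eventually_lt tendsto_const_nhds hc1).and
          (mem_nhdsWithin_of_mem_nhds (Iio_mem_nhds h))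
      obtain ⟨v, hv, hsub⟩ := (mem_nhdsGT_iff_exists_Ioo_subset' h).1 h1
      obtain ⟨n, hn⟩ := (TopologicalSpace.denseRange_denseSeq ℝ≥0).exists_mem_open isOpen_Ioo
        (nonempty_Ioo.2 hv)
      have h2 := hsub hn
      have h3 := ciInf_le hb2 n
      have h4 : min (TopologicalSpace.denseSeq ℝ≥0 n) T = TopologicalSpace.denseSeq ℝ≥0 n :=
        min_eq_left h2.2.le
      have h5 : f (min (TopologicalSpace.denseSeq ℝ≥0 n) T) ⊓ f T < c := by
        rw [h4]; exact lt_of_le_of_lt inf_le_left h2.1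
      linarith

end Cadlag

/-! ### Linear combinations of stochastic integrals -/

section Integral

variable {Ω : Type*} {mΩ : MeasurableSpace Ω} {ℱ : Filtration ℝ≥0 mΩ}
  {E : Type*} [NormedAddCommGroup E] [InnerProductSpace ℝ E]

/-- The elementary integrand `a H + b K`: the intervals of `H` followed by those of `K`. -/
def ElemIntegrand.linearComb (a b : ℝ) (H K : ElemIntegrand ℱ E) : ElemIntegrand ℱ E where
  n := H.n + K.n
  s := Fin.append H.s K.s
  t := Fin.append H.t K.t
  ξ := Fin.append (fun i => a • H.ξ i) (fun i => b • K.ξ i)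
  le i := by
    refine Fin.addCases (fun i => ?_) (fun i => ?_) i
    · simpa using H.le i
    · simpa using K.le i
  meas i := by
    refine Fin.addCases (fun i => ?_) (fun i => ?_) i
    · rw [Fin.append_left, Fin.append_left]
      exact (H.meas i).const_smul a
    · rw [Fin.append_right, Fin.append_right]
      exact (K.meas i).const_smul b
  bdd := by
    obtain ⟨c, hc⟩ := H.bdd
    obtain ⟨d, hd⟩ := K.bdd
    refine ⟨max (|a| * c) (|b| * d), fun i ω => ?_⟩
    refine Fin.addCases (fun i => ?_) (fun i => ?_) i
    · rw [Fin.append_left, Pi.smul_apply, norm_smul, Real.norm_eq_abs]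
      exact le_max_of_le_left (mul_le_mul_of_nonneg_left (hc i ω) (abs_nonneg a))
    · rw [Fin.append_right, Pi.smul_apply, norm_smul, Real.norm_eq_abs]
      exact le_max_of_le_right (mul_le_mul_of_nonneg_left (hd i ω) (abs_nonneg b))

lemma ElemIntegrand.linearComb_eval (a b : ℝ) (H K : ElemIntegrand ℱ E) :
    (H.linearComb a b K).eval = fun t ω => a • H.eval t ω + b • K.eval t ω := by
  funext t ω
  refine (Fin.sum_univ_add (a := H.n) (b := K.n) _).trans ?_
  simp only [eval, linearComb, Fin.append_left, Fin.append_right, Pi.smul_apply, Finset.smul_sum]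
  congr 1 <;> refine Finset.sum_congr rfl fun i _ => ?_ <;>
    simp only [indicator] <;> split_ifs <;> simp

lemma ElemIntegrand.linearComb_integral (a b : ℝ) (H K : ElemIntegrand ℱ E) (S : ℝ≥0 → Ω → E) :
    (H.linearComb a b K).integral S =
      fun t ω => a * H.integral S t ω + b * K.integral S t ω := by
  funext t ω
  refine (Fin.sum_univ_add (a := H.n) (b := K.n) _).trans ?_
  simp only [integral, linearComb, Fin.append_left, Fin.append_right, Pi.smul_apply,
    Finset.mul_sum, inner_smul_left, RCLike.conj_to_real]

variable {P : Measure Ω} {T : ℝ≥0} {S : ℝ≥0 → Ω → E}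

lemma emerySize_const_mul_le {a : ℝ} (ha : |a| ≤ 1) (Z : ℝ≥0 → Ω → ℝ) :
    emerySize ℱ P T (fun t ω => a * Z t ω) ≤ emerySize ℱ P T Z := by
  refine iSup₂_mono fun K _ => lintegral_mono fun ω => iSup₂_mono fun u _ => ?_
  have h : K.integral (fun t ω => a * Z t ω) u ω = a * K.integral Z u ω := by
    simp only [ElemIntegrand.integral, Finset.mul_sum, ← mul_sub]
    refine Finset.sum_congr rfl fun i _ => ?_
    rw [← smul_eq_mul, inner_smul_right]
  rw [h, abs_mul]
  exact min_le_min le_rfl (ENNReal.ofReal_le_ofReal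
    (mul_le_of_le_one_left (abs_nonneg _) ha))

lemma ElemIntegrand.stronglyMeasurable_integral (hS : IsSemimartingale ℱ P T S) (H : ElemIntegrand ℱ E)
    {u : ℝ≥0} (hu : u ≤ T) : StronglyMeasurable (H.integral S u) := by
  have hSm : ∀ v, StronglyMeasurable (S (min v u)) := fun v =>
    (hS.adapted _ ((min_le_right v u).trans hu)).mono (ℱ.le _)
  refine Finset.stronglyMeasurable_fun_sum _ fun i _ => ?_
  exact ((H.meas i).mono (ℱ.le _)).inner ((hSm _).sub (hSm _))

lemma ElemIntegrand.isCadlagOn_integral (H : ElemIntegrand ℱ E) {ω : Ω}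
    (hS : IsCadlagOn T (fun t => S t ω)) : IsCadlagOn T (fun t => H.integral S t ω) := by
  have h : ∀ i, IsCadlagOn T (fun u => inner ℝ (H.ξ i ω)
      (S (min (H.t i) u) ω - S (min (H.s i) u) ω)) := fun i => by
    have h1 := (hS.stopped (H.t i)).comp_continuous (φ := fun x => inner ℝ (H.ξ i ω) x) (by fun_prop)
    have h2 := (hS.stopped (H.s i)).comp_continuous (φ := fun x => inner ℝ (H.ξ i ω) x) (by fun_prop)
    have h3 := h1.linearComb h2 1 (-1)
    simp only [inner_sub_right]
    simpa [sub_eq_add_neg] using h3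
  refine ⟨fun t ht => ?_, fun t h0 ht => ?_⟩
  · simp only [ElemIntegrand.integral]
    exact tendsto_finsetSum _ fun i _ => (h i).1 t ht
  · choose l hl using fun i => (h i).2 t h0 ht
    exact ⟨∑ i, l i, tendsto_finsetSum _ fun i _ => hl i⟩

namespace IsStochIntegral

variable {H K : ℝ≥0 → Ω → E} {X Y : ℝ≥0 → Ω → ℝ}

lemma aestronglyMeasurable (hS : IsSemimartingale ℱ P T S) (h : IsStochIntegral ℱ P T S H X)
    {t : ℝ≥0} (ht : t ≤ T) : AEStronglyMeasurable (X t) P := by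
  cases h with
  | elem H => exact (H.stronglyMeasurable_integral hS ht).aestronglyMeasurable
  | lim Hs Xs _ _ _ _ meas => exact meas t ht

lemma ae_isCadlagOn (hS : IsSemimartingale ℱ P T S) (h : IsStochIntegral ℱ P T S H X) :
    ∀ᵐ ω ∂P, IsCadlagOn T (fun t => X t ω) := by
  cases h with
  | elem H => exact hS.cadlag.mono fun ω hω => H.isCadlagOn_integral hω
  | lim Hs Xs _ _ _ _ _ cadlag => exact cadlag

lemma ae_zero (h : IsStochIntegral ℱ P T S H X) : ∀ᵐ ω ∂P, X 0 ω = 0 := by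
  cases h with
  | elem H => exact ae_of_all _ fun ω => by simp [ElemIntegrand.integral]
  | lim Hs Xs _ _ _ _ _ _ zero => exact zero

/-- Stochastic integrals are stable under linear combinations. Coefficients of modulus at most `1`
suffice for convexity, and they do not increase the Émery size. -/
lemma linearComb (hS : IsSemimartingale ℱ P T S) {a b : ℝ} (ha : |a| ≤ 1) (hb : |b| ≤ 1)
    (hH : IsStochIntegral ℱ P T S H X) (hK : IsStochIntegral ℱ P T S K Y) :
    IsStochIntegral ℱ P T S (fun t ω => a • H t ω + b • K t ω)
      (fun t ω => a * X t ω + b * Y t ω) := by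
  have hsqueeze : ∀ {c : ℝ} {Xs : ℕ → ℝ≥0 → Ω → ℝ} {X : ℝ≥0 → Ω → ℝ}, |c| ≤ 1 →
      Tendsto (fun n => emerySize ℱ P T (fun t ω => Xs n t ω - X t ω)) atTop (𝓝 0) →
      Tendsto (fun n => emerySize ℱ P T (fun t ω => c * (Xs n t ω - X t ω))) atTop (𝓝 0) :=
    fun hc h => tendsto_of_tendsto_of_tendsto_of_le_of_le tendsto_const_nhds h
      (fun _ => zero_le) fun n => emerySize_const_mul_le hc _
  induction hH with
  | elem H =>
    induction hK with
    | elem K =>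
      rw [← ElemIntegrand.linearComb_eval, ← ElemIntegrand.linearComb_integral]
      exact .elem _
    | lim Ks Ys K Y hint pointwise meas cadlag zero emery ih =>
      have h0 := IsStochIntegral.elem (P := P) (T := T) (S := S) H
      refine .lim _ _ _ _ ih (fun t h0 ht ω => ((pointwise t h0 ht ω).const_smul b).const_add _)
        (fun t ht => ((h0.aestronglyMeasurable hS ht).const_mul a).add ((meas t ht).const_mul b))
        ?_ ?_ ?_
      · filter_upwards [h0.ae_isCadlagOn hS, cadlag] with ω h1 h2 using h1.linearComb h2 a b
      · filter_upwards [h0.ae_zero, zero] with ω h1 h2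
        simp [h1, h2]
      · refine (hsqueeze hb emery).congr fun n => ?_
        congr 1; funext t ω; ring
  | lim Hs Xs H X hint pointwise meas cadlag zero emery ih =>
    refine .lim _ _ _ _ ih (fun t h0 ht ω => ((pointwise t h0 ht ω).const_smul a).add_const _)
      (fun t ht => ((meas t ht).const_mul a).add ((hK.aestronglyMeasurable hS ht).const_mul b))
      ?_ ?_ ?_
    · filter_upwards [cadlag, hK.ae_isCadlagOn hS] with ω h1 h2 using h1.linearComb h2 a b
    · filter_upwards [zero, hK.ae_zero] with ω h1 h2
      simp [h1, h2]
    · refine (hsqueeze ha emery).congr fun n => ?_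
      congr 1; funext t ω; ring

lemma aestronglyMeasurable_iInf (hS : IsSemimartingale ℱ P T S)
    (h : IsStochIntegral ℱ P T S H X) :
    AEStronglyMeasurable (fun ω => ⨅ t : Icc (0 : ℝ≥0) T, X t ω) P := by
  have hm : AEMeasurable
      (fun ω => ⨅ n : ℕ, X (min (TopologicalSpace.denseSeq ℝ≥0 n) T) ω ⊓ X T ω) P :=
    AEMeasurable.iInf fun n => AEMeasurable.inf
      (h.aestronglyMeasurable hS (min_le_right _ _)).aemeasurable
      (h.aestronglyMeasurable hS le_rfl).aemeasurable
  refine (hm.congr ?_).aestronglyMeasurable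
  filter_upwards [h.ae_isCadlagOn hS] with ω hω using hω.iInf_eq.symm

end IsStochIntegral

variable {U : ℝ → EReal}

/-- Convex combinations of tame wealths are tame: the running infimum of `a X + b Y` lies between
`a inf X + b inf Y` and its value `0` at time `0`. -/
lemma convex_tameWealths (hS : IsSemimartingale ℱ P T S) (hU : IsUtility U) (h0 : U 0 = 0) :
    Convex ℝ (tameWealths ℱ P T S U) := by
  rintro _ ⟨H, X, hX, hXi, rfl⟩ _ ⟨K, Y, hY, hYi, rfl⟩ a b ha hb hab
  have hint := hX.linearComb hS (a := a) (b := b) (by rw [abs_of_nonneg ha]; linarith)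
    (by rw [abs_of_nonneg hb]; linarith) hY
  refine ⟨_, _, hint, ?_, ?_⟩
  · have hmem := add_mem_orlicz hU h0 (smul_mem_orlicz hU h0 a hXi) (smul_mem_orlicz hU h0 b hYi)
    refine mem_orlicz_of_abs_le hU h0 hmem (hint.aestronglyMeasurable_iInf hS) ?_
    filter_upwards [hX.ae_isCadlagOn hS, hY.ae_isCadlagOn hS, hint.ae_isCadlagOn hS, hX.ae_zero,
      hY.ae_zero] with ω h1 h2 h3 h4 h5
    have hbX := h1.bddBelow
    have hbY := h2.bddBelow
    have hbZ := h3.bddBelow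
    rw [image_eq_range] at hbX hbY hbZ
    have hT : (0 : ℝ≥0) ∈ Icc (0 : ℝ≥0) T := ⟨le_rfl, zero_le⟩
    have : Nonempty (Icc (0 : ℝ≥0) T) := ⟨⟨0, hT⟩⟩
    have hle : ⨅ t : Icc (0 : ℝ≥0) T, (a * X t ω + b * Y t ω) ≤ 0 := by
      refine (ciInf_le hbZ ⟨0, hT⟩).trans (le_of_eq ?_)
      simp [h4, h5]
    have hge : a * (⨅ t : Icc (0 : ℝ≥0) T, X t ω) + b * (⨅ t : Icc (0 : ℝ≥0) T, Y t ω) ≤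
        ⨅ t : Icc (0 : ℝ≥0) T, (a * X t ω + b * Y t ω) :=
      le_ciInf fun t => add_le_add (mul_le_mul_of_nonneg_left (ciInf_le hbX t) ha)
        (mul_le_mul_of_nonneg_left (ciInf_le hbY t) hb)
    rw [abs_of_nonpos hle]
    simp only [Pi.add_apply, Pi.smul_apply, smul_eq_mul]
    rw [abs_of_nonpos (hge.trans hle)]
    linarith
  · rfl

lemma superRep_subset_orlicz : superRep ℱ P T S U ⊆ orlicz P (young U) := fun _ h => h.1

lemma convex_superRep (hS : IsSemimartingale ℱ P T S) (hU : IsUtility U) (h0 : U 0 = 0) :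
    Convex ℝ (superRep ℱ P T S U) := by
  rintro X ⟨hX, k, hk, l, hlm, hl, hXk⟩ Y ⟨hY, k', hk', l', hlm', hl', hYk⟩ a b ha hb hab
  refine ⟨(orliczSpace P hU h0).convex hX hY ha hb hab, a • k + b • k',
    convex_tameWealths hS hU h0 hk hk' ha hb hab, a • l + b • l',
    (hlm.const_smul a).add (hlm'.const_smul b), ?_, ?_⟩
  · filter_upwards [hl, hl'] with ω h1 h2
    exact add_nonneg (mul_nonneg ha h1) (mul_nonneg hb h2)
  · filter_upwards [hXk, hYk] with ω h1 h2
    simp only [Pi.add_apply, Pi.smul_apply, Pi.sub_apply, h1, h2, smul_eq_mul]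
    ring

lemma convex_endowed (hS : IsSemimartingale ℱ P T S) (hU : IsUtility U) (h0 : U 0 = 0)
    (B : Ω → ℝ) : Convex ℝ (endowed ℱ P T S U B) :=
  (convex_superRep hS hU h0).translate B

lemma endowed_subset_orlicz (hU : IsUtility U) (h0 : U 0 = 0) {B : Ω → ℝ}
    (hB : B ∈ orlicz P (young U)) : endowed ℱ P T S U B ⊆ orlicz P (young U) := by
  rintro _ ⟨X, hX, rfl⟩
  exact add_mem_orlicz hU h0 hB (superRep_subset_orlicz hX)

end Integral

/-! ### The countably additive part of a positive linear functional -/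

section RegularPart

variable {Ω : Type*} [mΩ : MeasurableSpace Ω]

/-- `IsPositiveOn P L q`: the linear functional `q` is non-negative on the almost surely
non-negative elements of `L`, and `L` contains all bounded random variables. The values of `q`
outside `L` are irrelevant. -/
structure IsPositiveOn (P : Measure Ω) (L : Submodule ℝ (Ω → ℝ)) (q : (Ω → ℝ) →ₗ[ℝ] ℝ) :
    Prop where
  nonneg : ∀ W ∈ L, 0 ≤ᵐ[P] W → 0 ≤ q W
  bounded_mem : ∀ W : Ω → ℝ, AEStronglyMeasurable W P → ∀ k : ℝ, (∀ᵐ ω ∂P, |W ω| ≤ k) → W ∈ L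

/-- The finitely additive set function `A ↦ q (1_A)`, with value `∞` on non-measurable sets. -/
def indicatorContent (q : (Ω → ℝ) →ₗ[ℝ] ℝ) (A : Set Ω) : ℝ≥0∞ :=
  ⨅ _ : MeasurableSet A, ENNReal.ofReal (q (A.indicator 1))

lemma indicatorContent_of_measurable (q : (Ω → ℝ) →ₗ[ℝ] ℝ) {A : Set Ω} (hA : MeasurableSet A) :
    indicatorContent q A = ENNReal.ofReal (q (A.indicator 1)) := by
  simp [indicatorContent, hA]

lemma indicatorContent_empty (q : (Ω → ℝ) →ₗ[ℝ] ℝ) : indicatorContent q ∅ = 0 := by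
  rw [indicatorContent_of_measurable q MeasurableSet.empty, indicator_empty']
  exact ENNReal.ofReal_of_nonpos (map_zero q).le

namespace IsPositiveOn

variable {P : Measure Ω} {L : Submodule ℝ (Ω → ℝ)} {q : (Ω → ℝ) →ₗ[ℝ] ℝ}

lemma mono (hq : IsPositiveOn P L q) {W Z : Ω → ℝ} (hW : W ∈ L) (hZ : Z ∈ L) (h : W ≤ᵐ[P] Z) :
    q W ≤ q Z := by
  have := hq.nonneg (Z - W) (L.sub_mem hZ hW) (h.mono fun ω hω => sub_nonneg.2 hω)
  rw [map_sub] at this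
  linarith

lemma indicator_mem (hq : IsPositiveOn P L q) {A : Set Ω} (hA : MeasurableSet A) :
    A.indicator 1 ∈ L :=
  hq.bounded_mem _ (stronglyMeasurable_one.indicator hA).aestronglyMeasurable 1
    (ae_of_all _ fun ω => by by_cases h : ω ∈ A <;> simp [h])

lemma indicator_nonneg (hq : IsPositiveOn P L q) {A : Set Ω} (hA : MeasurableSet A) :
    0 ≤ q (A.indicator 1) :=
  hq.nonneg _ (hq.indicator_mem hA) (ae_of_all _ fun ω => Set.indicator_nonneg (fun _ _ => zero_le_one) ω)

lemma indicatorContent_inter_add_diff (hq : IsPositiveOn P L q) {A : Set Ω} (hA : MeasurableSet A)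
    (t : Set Ω) :
    indicatorContent q (t ∩ A) + indicatorContent q (t \ A) ≤ indicatorContent q t := by
  by_cases ht : MeasurableSet t
  · rw [indicatorContent_of_measurable q ht, indicatorContent_of_measurable q (ht.inter hA),
      indicatorContent_of_measurable q (ht.diff hA),
      ← ENNReal.ofReal_add (hq.indicator_nonneg (ht.inter hA)) (hq.indicator_nonneg (ht.diff hA)),
      ← map_add]
    refine (congrArg _ (congrArg q ?_)).le
    funext ω
    by_cases h1 : ω ∈ t <;> by_cases h2 : ω ∈ A <;> simp [h1, h2]
  · simp [indicatorContent, ht]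

lemma indicatorContent_union_le (hq : IsPositiveOn P L q) {A B : Set Ω} (hA : MeasurableSet A)
    (hB : MeasurableSet B) :
    indicatorContent q (A ∪ B) ≤ indicatorContent q A + indicatorContent q B := by
  rw [indicatorContent_of_measurable q hA, indicatorContent_of_measurable q hB,
    indicatorContent_of_measurable q (hA.union hB),
    ← ENNReal.ofReal_add (hq.indicator_nonneg hA) (hq.indicator_nonneg hB), ← map_add]
  refine ENNReal.ofReal_le_ofReal (hq.mono (hq.indicator_mem (hA.union hB))
    (L.add_mem (hq.indicator_mem hA) (hq.indicator_mem hB)) (ae_of_all _ fun ω => ?_))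
  by_cases h1 : ω ∈ A <;> by_cases h2 : ω ∈ B <;> simp [h1, h2]

lemma measurableSet_accumulate {t : ℕ → Set Ω} (ht : ∀ n, MeasurableSet (t n)) (n : ℕ) :
    MeasurableSet (accumulate t n) :=
  MeasurableSet.biUnion (to_countable _) fun i _ => ht i

lemma indicatorContent_accumulate_le (hq : IsPositiveOn P L q) {t : ℕ → Set Ω}
    (ht : ∀ n, MeasurableSet (t n)) (n : ℕ) :
    indicatorContent q (accumulate t n) ≤ ∑ i ∈ Finset.range (n + 1), indicatorContent q (t i) := by
  induction n with
  | zero => simp [accumulate_zero_nat]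
  | succ n ih =>
    rw [accumulate_succ, Finset.sum_range_succ]
    exact (hq.indicatorContent_union_le (measurableSet_accumulate ht n) (ht _)).trans
      (by gcongr)

/-- The countably additive part of a positive functional `q`: the outer measure generated by
`A ↦ q (1_A)`. It is dominated by `q`, and on sets of probability arbitrarily close to one it
almost exhausts `q`. The latter is the part of the Yosida–Hewitt decomposition that says that the
singular remainder of `q` lives on arbitrarily small sets. -/
theorem exists_regularPart [IsProbabilityMeasure P] (hq : IsPositiveOn P L q) :
    ∃ μ : Measure Ω, IsFiniteMeasure μ ∧ μ ≪ P ∧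
      (∀ A, MeasurableSet A → μ A ≤ ENNReal.ofReal (q (A.indicator 1))) ∧
      ∀ ε : ℝ, 0 < ε → ∃ A, MeasurableSet A ∧ P Aᶜ ≤ ENNReal.ofReal ε ∧
        q (A.indicator 1) ≤ μ.real A + ε := by
  set μ₀ := OuterMeasure.ofFunction (indicatorContent q) (indicatorContent_empty q)
  have hcar : mΩ ≤ μ₀.caratheodory := fun A hA =>
    OuterMeasure.ofFunction_caratheodory (hq.indicatorContent_inter_add_diff hA)
  set μ := μ₀.toMeasure hcar
  have hμ : ∀ A, MeasurableSet A → μ A = μ₀ A := fun A hA => toMeasure_apply _ _ hA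
  have hle : ∀ A, MeasurableSet A → μ A ≤ ENNReal.ofReal (q (A.indicator 1)) := fun A hA => by
    rw [hμ A hA, ← indicatorContent_of_measurable q hA]
    exact OuterMeasure.ofFunction_le A
  have hfin : IsFiniteMeasure μ := ⟨(hle univ MeasurableSet.univ).trans_lt ENNReal.ofReal_lt_top⟩
  refine ⟨μ, hfin, ?_, hle, fun ε hε => ?_⟩
  · refine Measure.AbsolutelyContinuous.mk fun A hA h0 => ?_
    refine le_antisymm ((hle A hA).trans ?_) zero_le
    have h1 : q (A.indicator 1) ≤ q 0 := by
      refine hq.mono (hq.indicator_mem hA) L.zero_mem ?_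
      have : ∀ᵐ ω ∂P, ω ∉ A := measure_eq_zero_iff_ae_notMem.1 h0
      filter_upwards [this] with ω hω
      simp [hω]
    rw [map_zero] at h1
    simp [ENNReal.ofReal_of_nonpos h1]
  · have hε2 : (0 : ℝ≥0∞) < ENNReal.ofReal (ε / 2) := by simpa using hε
    have hlt : μ₀ univ < μ univ + ENNReal.ofReal (ε / 2) := by
      rw [← hμ univ MeasurableSet.univ]
      exact ENNReal.lt_add_right (measure_ne_top _ _) hε2.ne'
    rw [OuterMeasure.ofFunction_apply] at hlt
    obtain ⟨t, ht⟩ := iInf_lt_iff.1 hlt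
    obtain ⟨htu, ht⟩ := iInf_lt_iff.1 ht
    have htm : ∀ n, MeasurableSet (t n) := by
      intro n
      by_contra hn
      have h1 : indicatorContent q (t n) = ⊤ := by simp [indicatorContent, hn]
      have h2 := (ENNReal.le_tsum n).trans ht.le
      rw [h1, top_le_iff] at h2
      exact absurd h2 (ENNReal.add_ne_top.2 ⟨measure_ne_top _ _, ENNReal.ofReal_ne_top⟩)
    have hU : ⋃ n, t n = univ := univ_subset_iff.1 htu
    have hAm : ∀ n, MeasurableSet (accumulate t n) := measurableSet_accumulate htm
    have hμt : Tendsto (fun n => μ (accumulate t n)) atTop (𝓝 (μ univ)) := by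
      rw [← hU]; exact tendsto_measure_iUnion_accumulate
    have hPt : Tendsto (fun n => P (accumulate t n)) atTop (𝓝 1) := by
      rw [← measure_univ (μ := P), ← hU]; exact tendsto_measure_iUnion_accumulate
    have hev1 : ∀ᶠ n in atTop, μ univ < μ (accumulate t n) + ENNReal.ofReal (ε / 2) :=
      (hμt.add_const _).eventually_const_lt
        (ENNReal.lt_add_right (measure_ne_top _ _) hε2.ne')
    have hev2 : ∀ᶠ n in atTop, 1 < P (accumulate t n) + ENNReal.ofReal ε :=
      (hPt.add_const _).eventually_const_lt
        (ENNReal.lt_add_right ENNReal.one_ne_top (by simpa using hε))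
    obtain ⟨n, h1, h2⟩ := (hev1.and hev2).exists
    refine ⟨accumulate t n, hAm n, ?_, ?_⟩
    · rw [prob_compl_eq_one_sub (hAm n)]
      exact tsub_le_iff_left.2 h2.le
    · have h3 : ENNReal.ofReal (q ((accumulate t n).indicator 1)) ≤
          μ (accumulate t n) + ENNReal.ofReal ε := by
        rw [← indicatorContent_of_measurable q (hAm n)]
        calc indicatorContent q (accumulate t n)
            ≤ ∑' i, indicatorContent q (t i) :=
              (hq.indicatorContent_accumulate_le htm n).trans (ENNReal.sum_le_tsum _)
          _ ≤ μ univ + ENNReal.ofReal (ε / 2) := ht.le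
          _ ≤ μ (accumulate t n) + ENNReal.ofReal (ε / 2) + ENNReal.ofReal (ε / 2) := by gcongr
          _ = μ (accumulate t n) + ENNReal.ofReal ε := by
              rw [add_assoc, ← ENNReal.ofReal_add (by positivity) (by positivity), add_halves]
      rw [← ofReal_measureReal, ← ENNReal.ofReal_add measureReal_nonneg hε.le] at h3
      exact (ENNReal.ofReal_le_ofReal_iff (add_nonneg measureReal_nonneg hε.le)).1 h3

variable {μ : Measure Ω}

lemma simpleFunc_lintegral_le (hq : IsPositiveOn P L q)
    (hμ : ∀ A, MeasurableSet A → μ A ≤ ENNReal.ofReal (q (A.indicator 1)))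
    (φ : SimpleFunc Ω ℝ≥0) :
    (fun ω => ((φ ω : ℝ≥0) : ℝ)) ∈ L ∧
      ∫⁻ ω, φ ω ∂μ ≤ ENNReal.ofReal (q (fun ω => ((φ ω : ℝ≥0) : ℝ))) := by
  induction φ using SimpleFunc.induction with
  | const c hs =>
    rename_i s
    have h : (fun ω => ((SimpleFunc.piecewise s hs (SimpleFunc.const Ω c) (SimpleFunc.const Ω 0) ω
        : ℝ≥0) : ℝ)) = (c : ℝ) • s.indicator 1 := by
      funext ω
      by_cases hω : ω ∈ s <;> simp [hω]
    have h2 : ∀ ω, ((SimpleFunc.piecewise s hs (SimpleFunc.const Ω c) (SimpleFunc.const Ω 0) ω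
        : ℝ≥0) : ℝ≥0∞) = s.indicator (fun _ => (c : ℝ≥0∞)) ω := fun ω => by
      by_cases hω : ω ∈ s <;> simp [hω]
    rw [h]
    refine ⟨L.smul_mem _ (hq.indicator_mem hs), ?_⟩
    rw [lintegral_congr h2, lintegral_indicator_const hs, map_smul, smul_eq_mul,
      ENNReal.ofReal_mul c.coe_nonneg, ENNReal.ofReal_coe_nnreal]
    gcongr
    exact hμ s hs
  | @add f g hd hf hg =>
    have h : (fun ω => (((f + g : SimpleFunc Ω ℝ≥0) ω : ℝ≥0) : ℝ)) =
        (fun ω => ((f ω : ℝ≥0) : ℝ)) + fun ω => ((g ω : ℝ≥0) : ℝ) := by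
      funext ω; simp
    rw [h]
    refine ⟨L.add_mem hf.1 hg.1, ?_⟩
    rw [map_add, ENNReal.ofReal_add (hq.nonneg _ hf.1 (ae_of_all _ fun ω => by simp))
      (hq.nonneg _ hg.1 (ae_of_all _ fun ω => by simp))]
    simp only [SimpleFunc.coe_add, Pi.add_apply, ENNReal.coe_add]
    rw [lintegral_add_left (by fun_prop)]
    exact add_le_add hf.2 hg.2

lemma lintegral_le (hq : IsPositiveOn P L q)
    (hμ : ∀ A, MeasurableSet A → μ A ≤ ENNReal.ofReal (q (A.indicator 1)))
    {W : Ω → ℝ} (hW : W ∈ L) (hW0 : 0 ≤ᵐ[P] W) :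
    ∫⁻ ω, ENNReal.ofReal (W ω) ∂μ ≤ ENNReal.ofReal (q W) := by
  rw [lintegral_eq_nnreal]
  refine iSup₂_le fun φ hφ => ?_
  obtain ⟨h1, h2⟩ := hq.simpleFunc_lintegral_le hμ φ
  rw [← SimpleFunc.lintegral_eq_lintegral]
  refine (le_trans (le_of_eq (by simp)) h2).trans (ENNReal.ofReal_le_ofReal (hq.mono h1 hW ?_))
  filter_upwards [hW0] with ω hω
  have := hφ ω
  rw [← ENNReal.ofReal_coe_nnreal] at this
  exact (ENNReal.ofReal_le_ofReal_iff hω).1 this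

lemma integrable (hq : IsPositiveOn P L q) (hμP : μ ≪ P)
    (hμ : ∀ A, MeasurableSet A → μ A ≤ ENNReal.ofReal (q (A.indicator 1)))
    {W : Ω → ℝ} (hWm : AEStronglyMeasurable W P) (hW : (fun ω => |W ω|) ∈ L) :
    Integrable W μ := by
  refine ⟨hWm.mono_ac hμP, ?_⟩
  have := hq.lintegral_le hμ hW (ae_of_all _ fun ω => abs_nonneg _)
  rw [hasFiniteIntegral_iff_norm]
  exact this.trans_lt ENNReal.ofReal_lt_top

lemma integral_le (hq : IsPositiveOn P L q) (hμP : μ ≪ P)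
    (hμ : ∀ A, MeasurableSet A → μ A ≤ ENNReal.ofReal (q (A.indicator 1)))
    {W : Ω → ℝ} (hWm : AEStronglyMeasurable W P) (hW : W ∈ L) (hW0 : 0 ≤ᵐ[P] W) :
    ∫ ω, W ω ∂μ ≤ q W := by
  rw [integral_eq_lintegral_of_nonneg_ae (hμP hW0) (hWm.mono_ac hμP)]
  exact ENNReal.toReal_le_of_le_ofReal (hq.nonneg W hW hW0) (hq.lintegral_le hμ hW hW0)

/-- On bounded random variables supported in `A` the singular remainder `q - μ` is at most the
bound times its mass on `A`. -/
lemma apply_le_integral_add [IsFiniteMeasure μ] (hq : IsPositiveOn P L q) (hμP : μ ≪ P)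
    (hμ : ∀ A, MeasurableSet A → μ A ≤ ENNReal.ofReal (q (A.indicator 1)))
    {W : Ω → ℝ} (hWm : AEStronglyMeasurable W P) {k : ℝ} (hk : ∀ ω, |W ω| ≤ k)
    {A : Set Ω} (hA : MeasurableSet A) (hWA : ∀ ω, ω ∉ A → W ω = 0) :
    q W ≤ ∫ ω, W ω ∂μ + k * (q (A.indicator 1) - μ.real A) := by
  have hW : W ∈ L := hq.bounded_mem W hWm k (ae_of_all _ hk)
  have h1m : AEStronglyMeasurable (A.indicator 1 : Ω → ℝ) P :=
    (stronglyMeasurable_one.indicator hA).aestronglyMeasurable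
  have hWi : Integrable W μ := by
    refine Integrable.of_bound (hWm.mono_ac hμP) k (ae_of_all _ fun ω => ?_)
    simpa using hk ω
  have h1i : Integrable (A.indicator 1 : Ω → ℝ) μ := (integrable_const (1 : ℝ)).indicator hA
  have h := hq.integral_le hμP hμ (W := k • A.indicator 1 - W) ((h1m.const_smul k).sub hWm)
    (L.sub_mem (L.smul_mem k (hq.indicator_mem hA)) hW) (ae_of_all _ fun ω => by
      by_cases hω : ω ∈ A
      · simpa [hω] using (le_abs_self _).trans (hk ω)
      · simp [hω, hWA ω hω])
  have h2 : ∫ ω, (k • A.indicator (1 : Ω → ℝ) - W) ω ∂μ = k * μ.real A - ∫ ω, W ω ∂μ := by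
    rw [integral_sub' (h1i.smul k) hWi]
    simp only [Pi.smul_apply]
    rw [integral_smul, integral_indicator_one hA, smul_eq_mul]
  rw [h2, map_sub, map_smul, smul_eq_mul] at h
  linarith

end IsPositiveOn

end RegularPart

/-! ### Supergradients of the value function -/

/-- Algebraic separation: a convex set in `L × ℝ` that meets the axis over `0` only in non-negative
heights, and whose projection absorbs `L`, lies above the graph of a linear functional. -/
lemma exists_linearMap_nonneg_add {L : Type*} [AddCommGroup L] [Module ℝ L] {G : Set (L × ℝ)}
    (hG : Convex ℝ G) (hzero : ∀ r : ℝ, ((0 : L), r) ∈ G → 0 ≤ r)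
    (habs : ∀ h : L, ∃ t : ℝ, 0 < t ∧ ∃ r : ℝ, (t • h, r) ∈ G) :
    ∃ q : L →ₗ[ℝ] ℝ, ∀ p ∈ G, 0 ≤ q p.1 + p.2 := by
  have hcone : ∀ x, x ∈ ConvexCone.hull ℝ G ↔ ∃ t : ℝ, 0 < t ∧ t • x ∈ G := fun x => by
    rw [← SetLike.mem_coe, ConvexCone.coe_hull_of_convex hG]
    constructor
    · rintro ⟨t, ht, y, hy, rfl⟩
      exact ⟨t⁻¹, inv_pos.2 ht, by simpa [smul_smul, inv_mul_cancel₀ (ne_of_gt ht)] using hy⟩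
    · rintro ⟨t, ht, hx⟩
      exact ⟨t⁻¹, inv_pos.2 ht, t • x, hx, by simp [smul_smul, inv_mul_cancel₀ ht.ne']⟩
  let C : PointedCone ℝ (L × ℝ) :=
    { carrier := {x | x = 0 ∨ x ∈ ConvexCone.hull ℝ G}
      zero_mem' := Or.inl rfl
      add_mem' := by
        rintro x y (rfl | hx) (rfl | hy)
        · exact Or.inl (by simp)
        · exact Or.inr (by simpa using hy)
        · exact Or.inr (by simpa using hx)
        · exact Or.inr ((ConvexCone.hull ℝ G).add_mem hx hy)
      smul_mem' := by
        rintro ⟨c, hc⟩ x (rfl | hx)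
        · exact Or.inl (by simp)
        · rcases eq_or_lt_of_le hc with h | h
          · left
            subst h
            exact zero_smul ℝ x
          · right
            exact (ConvexCone.hull ℝ G).smul_mem h hx }
  have hCmem : ∀ x, x ∈ C ↔ x = 0 ∨ x ∈ ConvexCone.hull ℝ G := fun x => Iff.rfl
  let f : (L × ℝ) →ₗ.[ℝ] ℝ :=
    ⟨LinearMap.range (LinearMap.inr ℝ L ℝ), (LinearMap.snd ℝ L ℝ).comp (Submodule.subtype _)⟩
  obtain ⟨g, hgf, hg⟩ := riesz_extension C f
    (by
      rintro ⟨_, r, rfl⟩ hx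
      change 0 ≤ r
      rcases (hCmem _).1 hx with h | h
      · exact (congrArg Prod.snd h).ge
      · obtain ⟨t, ht, h⟩ := (hcone _).1 h
        have h1 : t • (LinearMap.inr ℝ L ℝ) r = ((0 : L), t * r) := by simp
        change t • (LinearMap.inr ℝ L ℝ) r ∈ G at h
        rw [h1] at h
        exact nonneg_of_mul_nonneg_right (hzero _ h) ht)
    (by
      rintro ⟨h, r⟩
      obtain ⟨t, ht, s, hs⟩ := habs h
      refine ⟨⟨LinearMap.inr ℝ L ℝ (s / t - r), ⟨_, rfl⟩⟩, (hCmem _).2 (Or.inr ?_)⟩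
      refine (hcone _).2 ⟨t, ht, ?_⟩
      convert hs using 1
      ext
      · simp
      · simp; field_simp)
  refine ⟨g.comp (LinearMap.inl ℝ L ℝ), fun p hp => ?_⟩
  have h1 : g (0, p.2) = p.2 := hgf ⟨LinearMap.inr ℝ L ℝ p.2, ⟨_, rfl⟩⟩
  have h2 : 0 ≤ g p := hg p ((hCmem _).2 (Or.inr ((hcone _).2 ⟨1, one_pos, by simpa using hp⟩)))
  have h3 : p = LinearMap.inl ℝ L ℝ p.1 + (0, p.2) := by ext <;> simp
  rw [h3, map_add, h1] at h2
  exact h2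

section Duality

variable {Ω : Type*} [MeasurableSpace Ω] {P : Measure Ω} {U : ℝ → EReal}

lemma aemeasurable_utility (hU : IsUtility U) {X : Ω → ℝ} (hX : AEStronglyMeasurable X P) :
    AEMeasurable (fun ω => U (X ω)) P := hU.measurable.comp_aemeasurable hX.aemeasurable

lemma exists_minorant [IsFiniteMeasure P] (hU : IsUtility U) {X : Ω → ℝ}
    (hX : AEStronglyMeasurable X P) {c : ℝ} (hc : (c : EReal) < integralFunctional P U X) :
    ∃ g : Ω → ℝ, Integrable g P ∧ (∀ᵐ ω ∂P, (g ω : EReal) ≤ U (X ω)) ∧ c < ∫ ω, g ω ∂P :=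
  exists_integrable_le_of_lt_expect (aemeasurable_utility hU hX) hc

/-- Concavity of the expected utility, in terms of strict lower bounds. -/
lemma lt_integralFunctional_convexComb [IsFiniteMeasure P] (hU : IsUtility U) {X Z : Ω → ℝ}
    (hX : AEStronglyMeasurable X P) (hZ : AEStronglyMeasurable Z P) {c d s t : ℝ}
    (hc : (c : EReal) < integralFunctional P U X) (hd : (d : EReal) < integralFunctional P U Z)
    (hs : 0 ≤ s) (ht : 0 ≤ t) (hst : s + t = 1) :
    ((s * c + t * d : ℝ) : EReal) < integralFunctional P U (s • X + t • Z) := by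
  obtain ⟨g, hg, hgX, hcg⟩ := exists_minorant hU hX hc
  obtain ⟨h, hh, hhZ, hdh⟩ := exists_minorant hU hZ hd
  have h1 : s * c + t * d < ∫ ω, (s * g ω + t * h ω) ∂P := by
    rw [integral_add (hg.const_mul s) (hh.const_mul t), integral_const_mul, integral_const_mul]
    rcases eq_or_lt_of_le hs with h0 | h0
    · rw [← h0] at hst ⊢
      have : t = 1 := by linarith
      rw [this]; linarith
    · nlinarith
  refine (EReal.coe_lt_coe_iff.2 h1).trans_le
    (integral_le_expect ((hg.const_mul s).add (hh.const_mul t)) ?_)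
  filter_upwards [hgX, hhZ] with ω h2 h3
  exact hU.coe_le_of_convexComb h2 h3 hs ht hst


/-- A supergradient at `0` of the value function `h ↦ sup_{X ∈ 𝒜} I_U(X + h)`. Only algebraic
separation is needed, because `0` is in the algebraic interior of the domain of this function. -/
theorem exists_supergradient [IsFiniteMeasure P] (hU : IsUtility U) (h0 : U 0 = 0)
    {𝒜 : Set (Ω → ℝ)} (hconv : Convex ℝ 𝒜) (hsub : 𝒜 ⊆ orlicz P (young U))
    (hcore : (𝒜 ∩ algCore P (young U) (utilDom P U)).Nonempty) {u : ℝ}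
    (hu : ∀ X ∈ 𝒜, integralFunctional P U X ≤ u) :
    ∃ q : (Ω → ℝ) →ₗ[ℝ] ℝ, ∀ X ∈ 𝒜, ∀ Z ∈ orlicz P (young U), ∀ c : ℝ,
      (c : EReal) < integralFunctional P U Z → c ≤ u + q (Z - X) := by
  set L := orliczSpace P hU h0
  let G : Set (L × ℝ) :=
    {p | ∃ X ∈ 𝒜, ((u - p.2 : ℝ) : EReal) < integralFunctional P U ((p.1 : Ω → ℝ) + X)}
  have hG : Convex ℝ G := by
    rintro ⟨h, r⟩ ⟨X, hX, hXr⟩ ⟨k, v⟩ ⟨Z, hZ, hZv⟩ a b ha hb hab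
    refine ⟨a • X + b • Z, hconv hX hZ ha hb hab, ?_⟩
    have := lt_integralFunctional_convexComb hU
      (h.2.1.add (hsub hX).1) (k.2.1.add (hsub hZ).1) hXr hZv ha hb hab
    convert this using 1
    · congr 1
      simp only [Prod.smul_mk, Prod.mk_add_mk, smul_eq_mul]
      linear_combination -u * hab
    · congr 1
      simp only [Prod.smul_mk, Prod.mk_add_mk, Submodule.coe_add, Submodule.coe_smul, smul_add]
      abel
  obtain ⟨q₀, hq₀⟩ := exists_linearMap_nonneg_add hG
    (by
      rintro r ⟨X, hX, hr⟩
      have h1 : (((0 : L) : Ω → ℝ) + X) = X := by simp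
      simp only [h1] at hr
      have := hr.trans_le (hu X hX)
      rw [EReal.coe_lt_coe_iff] at this
      linarith)
    (by
      intro h
      obtain ⟨X, hX, -, hXcore⟩ := hcore
      obtain ⟨ε, hε, hε'⟩ := hXcore h h.2
      obtain ⟨c, -, hc⟩ := EReal.lt_iff_exists_real_btwn.1 (hε' ε hε.le le_rfl).2
      refine ⟨ε, hε, u - c, X, hX, ?_⟩
      have h1 : (((ε • h : L) : Ω → ℝ) + X) = fun ω => X ω + ε * (h : Ω → ℝ) ω := by
        funext ω; simp [add_comm]
      simp only [h1, sub_sub_cancel]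
      exact hc)
  obtain ⟨q, hq⟩ := LinearMap.exists_extend q₀
  refine ⟨q, fun X hX Z hZ c hc => ?_⟩
  have hmem : Z - X ∈ L := L.sub_mem hZ (hsub hX)
  have h1 := hq₀ (⟨Z - X, hmem⟩, u - c) ⟨X, hX, by simpa using hc⟩
  have h2 : q (Z - X) = q₀ ⟨Z - X, hmem⟩ := by rw [← hq]; rfl
  rw [h2]
  linarith

/-- The supergradient is a positive functional since `U` is non-decreasing. -/
lemma isPositiveOn_supergradient [IsFiniteMeasure P] (hU : IsUtility U) (hN : IsNormalized U)
    {𝒜 : Set (Ω → ℝ)} (hsub : 𝒜 ⊆ orlicz P (young U)) (hne : (𝒜 ∩ utilDom P U).Nonempty) {u : ℝ}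
    {q : (Ω → ℝ) →ₗ[ℝ] ℝ} (hq : ∀ X ∈ 𝒜, ∀ Z ∈ orlicz P (young U), ∀ c : ℝ,
      (c : EReal) < integralFunctional P U Z → c ≤ u + q (Z - X)) :
    IsPositiveOn P (orliczSpace P hU hN.zero) q := by
  refine ⟨fun W hW hW0 => ?_, fun W hW k hk => bounded_mem_orlicz hU hN hW hk⟩
  obtain ⟨X, hX, -, hXU⟩ := hne
  obtain ⟨c, -, hc⟩ := EReal.lt_iff_exists_real_btwn.1 hXU
  by_contra! hneg
  set t := (|u - c| + 1) / -q W
  have ht : 0 < t := div_pos (by positivity) (by linarith)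
  have hle : integralFunctional P U X ≤ integralFunctional P U (X + t • W) := by
    refine expect_mono (hW0.mono fun ω hω => hU.mono ?_)
    have : 0 ≤ t * W ω := mul_nonneg ht.le hω
    simpa using this
  have h1 := hq X hX (X + t • W)
    (add_mem_orlicz hU hN.zero (hsub hX) (smul_mem_orlicz hU hN.zero t hW)) c (hc.trans_le hle)
  rw [add_sub_cancel_left, map_smul, smul_eq_mul] at h1
  have h2 : t * q W = -(|u - c| + 1) := by
    simp only [t]
    field_simp [hneg.ne]
  rw [h2] at h1
  linarith [le_abs_self (u - c)]

end Duality

/-! ### The dual utility and weak duality -/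

section DualUtility

variable {U : ℝ → EReal}

lemma le_dualUtility {a x : ℝ} (ha : (a : EReal) ≤ U x) (y : ℝ) :
    ((a - x * y : ℝ) : EReal) ≤ dualUtility U y := by
  have h1 : concaveConj U y ≤ ((x * y : ℝ) : EReal) - U x := iInf_le _ x
  have h2 : ((x * y : ℝ) : EReal) - U x ≤ ((x * y : ℝ) : EReal) - (a : EReal) :=
    EReal.sub_le_sub le_rfl ha
  have h3 := EReal.neg_le_neg_iff.2 (h1.trans h2)
  rw [← EReal.coe_sub, ← EReal.coe_neg, neg_sub] at h3
  exact h3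

lemma dualUtility_nonneg (h0 : U 0 = 0) (y : ℝ) : 0 ≤ dualUtility U y := by
  have := le_dualUtility (U := U) (a := 0) (x := 0) (by simp [h0]) y
  simpa using this

lemma sub_young_le_conjYoung (x y : ℝ) {b : ℝ} (hb : young U x = b) :
    ((x * y - b : ℝ) : EReal) ≤ conjYoung U y := by
  rw [EReal.coe_sub, ← hb]
  exact le_iSup (fun x : ℝ => ((x * y : ℝ) : EReal) - young U x) x

lemma conjYoung_nonneg (h0 : U 0 = 0) (y : ℝ) : 0 ≤ conjYoung U y := by
  have := sub_young_le_conjYoung (U := U) 0 y (b := 0) (by simp [young, h0])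
  simpa using this

/-- For non-negative `y` the conjugate Young function is the restriction to the left tail of the
supremum that defines `V`. -/
lemma conjYoung_le_dualUtility (hU : IsUtility U) {y : ℝ} (hy : 0 ≤ y) :
    conjYoung U y ≤ dualUtility U y := by
  refine iSup_le fun x => ?_
  by_cases hx : U (-|x|) = ⊥
  · simp [young, hx]
  · obtain ⟨b, hb⟩ : ∃ b : ℝ, (b : EReal) = U (-|x|) := ⟨_, hU.coe_toReal hx⟩
    refine le_trans ?_ (le_dualUtility hb.le y)
    rw [young, ← hb, ← EReal.coe_neg, ← EReal.coe_sub, EReal.coe_le_coe_iff]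
    nlinarith [le_abs_self x]

/-- Young's inequality. -/
lemma ofReal_abs_mul_le (hU : IsUtility U) (x y : ℝ) :
    ENNReal.ofReal |x * y| ≤ (young U x).toENNReal + (conjYoung U y).toENNReal := by
  by_cases hx : U (-|x|) = ⊥
  · simp [young, hx]
  · have h1 := hU.coe_toReal hx
    obtain ⟨z, hz, hzy⟩ : ∃ z : ℝ, |z| = |x| ∧ z * y = |x * y| := by
      rcases abs_choice (x * y) with h | h
      · exact ⟨x, rfl, h.symm⟩
      · exact ⟨-x, abs_neg x, by rw [h]; ring⟩
    set b := -(U (-|x|)).toReal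
    have hb : young U z = b := by rw [young, hz, ← h1, EReal.coe_neg]
    have hb' : young U x = b := by rw [young, ← h1, EReal.coe_neg]
    have h2 := sub_young_le_conjYoung z y hb
    rw [hzy] at h2
    calc ENNReal.ofReal |x * y| = ENNReal.ofReal (b + (|x * y| - b)) := by congr 1; ring
      _ ≤ ENNReal.ofReal b + ENNReal.ofReal (|x * y| - b) := ENNReal.ofReal_add_le
      _ ≤ _ := by
        rw [hb', EReal.real_coe_toENNReal]
        gcongr
        exact EReal.toENNReal_le_toENNReal h2

variable {Ω : Type*} [MeasurableSpace Ω] {P : Measure Ω}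

lemma integrable_mul_of_mem_orlicz (hU : IsUtility U) (h0 : U 0 = 0) {X Y : Ω → ℝ}
    (hX : X ∈ orlicz P (young U)) (hY : Y ∈ orlicz P (conjYoung U)) :
    Integrable (fun ω => X ω * Y ω) P := by
  obtain ⟨hXm, r, hr, hX⟩ := (mem_orlicz_young hU h0).1 hX
  obtain ⟨hYm, s, hs, hY⟩ := hY
  rw [expect_of_nonneg fun ω => conjYoung_nonneg h0 _] at hY
  have hY' : ∫⁻ ω, (conjYoung U (s * Y ω)).toENNReal ∂P < ⊤ := by
    rw [lt_top_iff_ne_top] at hY ⊢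
    exact fun h => hY (by simp [h])
  have h : Integrable (fun ω => (r * X ω) * (s * Y ω)) P := by
    refine ⟨(hXm.const_mul r).mul (hYm.const_mul s), ?_⟩
    rw [hasFiniteIntegral_iff_norm]
    calc ∫⁻ ω, ENNReal.ofReal ‖(r * X ω) * (s * Y ω)‖ ∂P
        ≤ ∫⁻ ω, (young U (r * X ω)).toENNReal + (conjYoung U (s * Y ω)).toENNReal ∂P :=
          lintegral_mono fun ω => ofReal_abs_mul_le hU _ _
      _ = ∫⁻ ω, (young U (r * X ω)).toENNReal ∂P + ∫⁻ ω, (conjYoung U (s * Y ω)).toENNReal ∂P :=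
          lintegral_add_left' (aemeasurable_young hU hXm r) _
      _ < ⊤ := ENNReal.add_lt_top.2 ⟨hX, hY'⟩
  refine (h.const_mul (r * s)⁻¹).congr (ae_of_all _ fun ω => ?_)
  field_simp

/-- Weak duality. -/
lemma integralFunctional_le_add [IsFiniteMeasure P] (hU : IsUtility U) (h0 : U 0 = 0)
    {X Y : Ω → ℝ} (hX : X ∈ orlicz P (young U)) (hY : Y ∈ orlicz P (conjYoung U)) :
    integralFunctional P U X ≤
      integralFunctional P (dualUtility U) Y + ((∫ ω, X ω * Y ω ∂P : ℝ) : EReal) := by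
  refine EReal.ge_of_forall_gt_iff_ge.1 fun c hc => ?_
  obtain ⟨g, hg, hgX, hcg⟩ := exists_minorant hU hX.1 hc
  have hXY := integrable_mul_of_mem_orlicz hU h0 hX hY
  have h1 := integral_le_expect (f := fun ω => dualUtility U (Y ω)) (hg.sub hXY)
    (hgX.mono fun ω hω => le_dualUtility hω (Y ω))
  have h2 : c ≤ (∫ ω, (g ω - X ω * Y ω) ∂P) + ∫ ω, X ω * Y ω ∂P := by
    rw [integral_sub hg hXY]; linarith
  calc (c : EReal) ≤ (((∫ ω, (g ω - X ω * Y ω) ∂P) + ∫ ω, X ω * Y ω ∂P : ℝ) : EReal) :=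
        EReal.coe_le_coe_iff.2 h2
    _ ≤ _ := by
      rw [EReal.coe_add]
      exact add_le_add_left h1 _

/-! ### Approximate optimizers in the dual utility -/

open Classical in
/-- The best response to the price `y` among `0` and the first `n` rational positions at which
`U` is finite. -/
def bestResponse (U : ℝ → EReal) (y : ℝ) : ℕ → ℝ
  | 0 => 0
  | n + 1 =>
    if U (Denumerable.ofNat ℚ n : ℚ) ≠ ⊥ ∧
        (U (bestResponse U y n)).toReal - bestResponse U y n * y <
          (U (Denumerable.ofNat ℚ n : ℚ)).toReal - (Denumerable.ofNat ℚ n : ℚ) * y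
    then (Denumerable.ofNat ℚ n : ℚ) else bestResponse U y n

/-- The net payoff `U(z) - z y` of the best response `z` to `y`. -/
def bestPayoff (U : ℝ → EReal) (n : ℕ) (y : ℝ) : ℝ :=
  (U (bestResponse U y n)).toReal - bestResponse U y n * y

lemma utility_bestResponse_ne_bot (h0 : U 0 = 0) (y : ℝ) (n : ℕ) :
    U (bestResponse U y n) ≠ ⊥ := by
  induction n with
  | zero => simp [bestResponse, h0]
  | succ n ih =>
    rw [bestResponse]
    split_ifs with h
    exacts [h.1, ih]

lemma measurable_bestResponse (hU : IsUtility U) (n : ℕ) :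
    Measurable fun y => bestResponse U y n := by
  induction n with
  | zero => exact measurable_const
  | succ n ih =>
    have hm := hU.measurable
    simp only [bestResponse]
    refine Measurable.ite ?_ measurable_const ih
    have h : MeasurableSet {y : ℝ | (U (bestResponse U y n)).toReal - bestResponse U y n * y <
        (U (Denumerable.ofNat ℚ n : ℚ)).toReal - (Denumerable.ofNat ℚ n : ℚ) * y} :=
      measurableSet_lt (((hm.comp ih).ereal_toReal).sub (ih.mul measurable_id))
        (measurable_const.sub (measurable_const.mul measurable_id))
    exact (MeasurableSet.const _).inter h

lemma exists_bound_bestResponse (n : ℕ) :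
    ∃ C : ℝ, ∀ y, |bestResponse U y n| ≤ C ∧ |(U (bestResponse U y n)).toReal| ≤ C := by
  induction n with
  | zero => exact ⟨max |(0 : ℝ)| |(U 0).toReal|, fun y => ⟨le_max_left _ _, le_max_right _ _⟩⟩
  | succ n ih =>
    obtain ⟨C, hC⟩ := ih
    refine ⟨max C (max |((Denumerable.ofNat ℚ n : ℚ) : ℝ)|
      |(U (Denumerable.ofNat ℚ n : ℚ)).toReal|), fun y => ?_⟩
    rw [bestResponse]
    split_ifs
    · exact ⟨le_max_of_le_right (le_max_left _ _), le_max_of_le_right (le_max_right _ _)⟩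
    · exact ⟨le_max_of_le_left (hC y).1, le_max_of_le_left (hC y).2⟩

lemma monotone_bestPayoff (y : ℝ) : Monotone fun n => bestPayoff U n y := by
  refine monotone_nat_of_le_succ fun n => ?_
  simp only [bestPayoff]
  rw [bestResponse]
  split_ifs with h
  · exact h.2.le
  · exact le_rfl

lemma le_bestPayoff {n : ℕ} (h : U (Denumerable.ofNat ℚ n : ℚ) ≠ ⊥) (y : ℝ) :
    (U (Denumerable.ofNat ℚ n : ℚ)).toReal - (Denumerable.ofNat ℚ n : ℚ) * y ≤
      bestPayoff U (n + 1) y := by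
  simp only [bestPayoff]
  rw [bestResponse]
  split_ifs with h1
  · exact le_rfl
  · rw [not_and, not_lt] at h1
    exact h1 h

lemma measurable_bestPayoff (hU : IsUtility U) (n : ℕ) : Measurable (bestPayoff U n) :=
  ((hU.measurable.comp (measurable_bestResponse hU n)).ereal_toReal).sub
    ((measurable_bestResponse hU n).mul measurable_id)

/-- Rational positions suffice in the supremum that defines `V`, since `U` is non-decreasing. -/
lemma dualUtility_le_iSup_bestPayoff (hU : IsUtility U) (y : ℝ) :
    dualUtility U y ≤ ((⨆ n, ENNReal.ofReal (bestPayoff U n y) : ℝ≥0∞) : EReal) := by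
  set a := ⨆ n, ENNReal.ofReal (bestPayoff U n y)
  rcases eq_or_ne a ⊤ with ha | ha
  · simp [ha]
  rw [← EReal.coe_ennreal_toReal ha, dualUtility, EReal.neg_le, ← EReal.coe_neg]
  refine le_iInf fun x => ?_
  by_cases hx : U x = ⊥
  · rw [hx, EReal.coe_sub_bot]
    exact le_top
  rw [← hU.coe_toReal hx, ← EReal.coe_sub, EReal.coe_le_coe_iff]
  suffices h : (U x).toReal - x * y ≤ a.toReal by linarith
  refine le_of_forall_pos_le_add fun δ hδ => ?_
  obtain ⟨p, hp1, hp2⟩ := exists_rat_btwn (show x < x + δ / (|y| + 1) by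
    have : 0 < δ / (|y| + 1) := by positivity
    linarith)
  obtain ⟨n, hp⟩ : ∃ n, Denumerable.ofNat ℚ n = p := ⟨_, Denumerable.ofNat_encode p⟩
  have hUp : U x ≤ U p := hU.mono hp1.le
  have hpb : U p ≠ ⊥ := fun h => hx (le_bot_iff.1 (h ▸ hUp))
  have h1 := le_bestPayoff (U := U) (n := n) (by rwa [hp]) y
  rw [hp] at h1
  have h2 : bestPayoff U (n + 1) y ≤ a.toReal :=
    (ENNReal.ofReal_le_iff_le_toReal ha).1
      (le_iSup (fun n => ENNReal.ofReal (bestPayoff U n y)) _)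
  have h3 : (U x).toReal ≤ (U p).toReal := EReal.toReal_le_toReal hUp hx (hU.lt_top p)
  have h4 : (p - x) * y ≤ δ := by
    have h5 : (p - x) * (|y| + 1) ≤ δ := by
      rw [← le_div_iff₀ (by positivity)]; linarith
    nlinarith [le_abs_self y, abs_nonneg y]
  linarith

end DualUtility

/-! ### Attainment in the dual problem -/

section Attainment

variable {Ω : Type*} [MeasurableSpace Ω] {P : Measure Ω} [IsProbabilityMeasure P] {U : ℝ → EReal}

/-- A sequence of measurable sets of probability tending to one on which a given `X` is bounded by
`n`, and on which the singular remainder `q - μ` is so small that it remains negligible when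
multiplied by `n + C`. -/
lemma exists_seq_of_regularPart {q : (Ω → ℝ) →ₗ[ℝ] ℝ} {μ : Measure Ω}
    (hμ : ∀ ε : ℝ, 0 < ε → ∃ A, MeasurableSet A ∧ P Aᶜ ≤ ENNReal.ofReal ε ∧
      q (A.indicator 1) ≤ μ.real A + ε)
    {X : Ω → ℝ} (hX : Measurable X) {C : ℝ} (hC : 0 ≤ C) :
    ∃ A B : ℕ → Set Ω, (∀ n, MeasurableSet (A n)) ∧ (∀ n, MeasurableSet (B n)) ∧
      (∀ n, A n ⊆ B n) ∧ (∀ n, ∀ ω ∈ A n, |X ω| ≤ n) ∧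
      (∀ n : ℕ, (n + C) * (q ((B n).indicator 1) - μ.real (B n)) ≤ 1 / ((n : ℝ) + 1)) ∧
      Tendsto (fun n => P (A n)ᶜ) atTop (𝓝 0) := by
  have hpos : ∀ n : ℕ, (0 : ℝ) < 1 / (((n : ℝ) + C + 1) * (n + 1)) := fun n => by positivity
  choose B hBm hBP hBq using fun n => hμ _ (hpos n)
  have hXm : ∀ n : ℕ, MeasurableSet {ω | |X ω| ≤ n} := fun n =>
    measurableSet_le hX.abs measurable_const
  refine ⟨fun n => B n ∩ {ω | |X ω| ≤ n}, B, fun n => (hBm n).inter (hXm n), hBm,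
    fun n => inter_subset_left, fun n ω hω => hω.2, fun n => ?_, ?_⟩
  · have h1 : q ((B n).indicator 1) - μ.real (B n) ≤ 1 / (((n : ℝ) + C + 1) * (n + 1)) := by
      linarith [hBq n]
    calc (n + C) * (q ((B n).indicator 1) - μ.real (B n))
        ≤ (n + C) * (1 / (((n : ℝ) + C + 1) * (n + 1))) := by gcongr
      _ ≤ 1 / ((n : ℝ) + 1) := by
        rw [mul_one_div, div_le_div_iff₀ (by positivity) (by positivity)]
        nlinarith [(n.cast_nonneg : (0 : ℝ) ≤ n)]
  · have h1 : Tendsto (fun n : ℕ => P {ω | |X ω| ≤ n}ᶜ) atTop (𝓝 0) := by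
      have h := tendsto_measure_iInter_atTop (μ := P) (s := fun n : ℕ => {ω | |X ω| ≤ n}ᶜ)
        (fun n => (hXm n).compl.nullMeasurableSet)
        (fun m n hmn => compl_subset_compl.2 fun ω (hω : |X ω| ≤ m) =>
          hω.trans (by exact_mod_cast hmn)) ⟨0, measure_ne_top _ _⟩
      have h0 : ⋂ n : ℕ, {ω | |X ω| ≤ n}ᶜ = ∅ := by
        rw [← compl_iUnion, compl_empty_iff, eq_univ_iff_forall]
        intro ω
        obtain ⟨n, hn⟩ := exists_nat_ge |X ω|
        exact mem_iUnion.2 ⟨n, hn⟩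
      rw [h0, measure_empty] at h
      exact h
    have h2 : Tendsto (fun n : ℕ => ENNReal.ofReal (1 / ((n : ℝ) + 1))) atTop (𝓝 0) := by
      simpa using ENNReal.tendsto_ofReal tendsto_one_div_add_atTop_nhds_zero_nat
    have h3 := h2.add h1
    rw [add_zero] at h3
    refine tendsto_of_tendsto_of_tendsto_of_le_of_le tendsto_const_nhds h3 (fun _ => zero_le)
      fun n => ?_
    simp only [compl_inter]
    refine (measure_union_le _ _).trans (add_le_add ((hBP n).trans ?_) le_rfl)
    refine ENNReal.ofReal_le_ofReal ?_
    rw [div_le_div_iff₀ (by positivity) (by positivity)]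
    nlinarith [(n.cast_nonneg : (0 : ℝ) ≤ n)]

lemma tendsto_measure_zero_of_absolutelyContinuous {μ : Measure Ω} [IsFiniteMeasure μ] (h : μ ≪ P)
    {D : ℕ → Set Ω} (hD : Tendsto (fun n => P (D n)) atTop (𝓝 0)) :
    Tendsto (fun n => μ (D n)) atTop (𝓝 0) := by
  have h1 := tendsto_setLIntegral_zero (f := μ.rnDeriv P) (Measure.lintegral_rnDeriv_lt_top μ P).ne
    (s := D) hD
  refine h1.congr fun n => ?_
  exact Measure.setLIntegral_rnDeriv h (D n)

/-- The supergradient inequality survives the passage to the countably additive part `μ`: it is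
applied to the competitor equal to `z` on a large set where `q` is almost `μ`, and equal to `X`
elsewhere. The singular part of `q` never sees this perturbation of `X`. -/
lemma integral_utility_le_of_regularPart (hU : IsUtility U) (hN : IsNormalized U)
    {𝒜 : Set (Ω → ℝ)} (hsub : 𝒜 ⊆ orlicz P (young U)) {u : ℝ} {q : (Ω → ℝ) →ₗ[ℝ] ℝ}
    (hq : ∀ X ∈ 𝒜, ∀ Z ∈ orlicz P (young U), ∀ c : ℝ,
      (c : EReal) < integralFunctional P U Z → c ≤ u + q (Z - X))
    (hpos : IsPositiveOn P (orliczSpace P hU hN.zero) q) {μ : Measure Ω} [IsFiniteMeasure μ]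
    (hμP : μ ≪ P) (hμ : ∀ A, MeasurableSet A → μ A ≤ ENNReal.ofReal (q (A.indicator 1)))
    (hμε : ∀ ε : ℝ, 0 < ε → ∃ A, MeasurableSet A ∧ P Aᶜ ≤ ENNReal.ofReal ε ∧
      q (A.indicator 1) ≤ μ.real A + ε)
    {X : Ω → ℝ} (hX : X ∈ 𝒜) (hXU : ⊥ < integralFunctional P U X) (hXμ : Integrable X μ)
    {z : Ω → ℝ} (hz : Measurable z) {C : ℝ} (hC : ∀ ω, |z ω| ≤ C ∧ |(U (z ω)).toReal| ≤ C)
    (hzU : ∀ ω, U (z ω) ≠ ⊥) :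
    ∫ ω, (U (z ω)).toReal ∂P ≤ u + (∫ ω, z ω ∂μ - ∫ ω, X ω ∂μ) := by
  obtain ⟨c, -, hc⟩ := EReal.lt_iff_exists_real_btwn.1 hXU
  obtain ⟨g, hg, hgX, -⟩ := exists_minorant hU (hsub hX).1 hc
  have hC0 : 0 ≤ C := by
    obtain ⟨ω⟩ := P.nonempty_of_neZero
    exact (abs_nonneg _).trans (hC ω).1
  obtain ⟨X', hX'm, hX'⟩ : ∃ X' : Ω → ℝ, Measurable X' ∧ X =ᵐ[P] X' :=
    ⟨(hsub hX).1.aemeasurable.mk, (hsub hX).1.aemeasurable.measurable_mk,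
      (hsub hX).1.aemeasurable.ae_eq_mk⟩
  obtain ⟨A, B, hA, hB, hAB, hAX, hBq, hAP⟩ := exists_seq_of_regularPart hμε hX'm hC0
  have ham : Measurable fun ω => (U (z ω)).toReal := (hU.measurable.comp hz).ereal_toReal
  have hai : Integrable (fun ω => (U (z ω)).toReal) P :=
    Integrable.of_bound ham.aestronglyMeasurable C (ae_of_all _ fun ω => by simpa using (hC ω).2)
  have hzi : Integrable z μ :=
    Integrable.of_bound hz.aestronglyMeasurable C (ae_of_all _ fun ω => by simpa using (hC ω).1)
  have hX'i : Integrable X' μ := hXμ.congr (hμP hX')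
  have key : ∀ n : ℕ, (∫ ω in A n, (U (z ω)).toReal ∂P) + ∫ ω in (A n)ᶜ, g ω ∂P ≤
      u + ((∫ ω in A n, (z ω - X' ω) ∂μ) + 1 / ((n : ℝ) + 1)) := by
    intro n
    set W : Ω → ℝ := (A n).indicator (fun ω => z ω - X' ω) with hW
    have hWm : Measurable W := (hz.sub hX'm).indicator (hA n)
    have hWb : ∀ ω, |W ω| ≤ n + C := fun ω => by
      by_cases hω : ω ∈ A n
      · rw [hW, indicator_of_mem hω]
        refine (abs_sub _ _).trans ?_
        linarith [(hC ω).1, hAX n ω hω]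
      · rw [hW, indicator_of_notMem hω, abs_zero]
        positivity
    have h1 : q W ≤ (∫ ω in A n, (z ω - X' ω) ∂μ) + 1 / ((n : ℝ) + 1) := by
      have := hpos.apply_le_integral_add hμP hμ hWm.aestronglyMeasurable hWb (hB n)
        (fun ω hω => indicator_of_notMem (fun h => hω (hAB n h)) _)
      rw [integral_indicator (hA n)] at this
      linarith [hBq n]
    have hWL : W ∈ orlicz P (young U) :=
      bounded_mem_orlicz hU hN hWm.aestronglyMeasurable (ae_of_all _ hWb)
    have hmin : (((∫ ω in A n, (U (z ω)).toReal ∂P) + ∫ ω in (A n)ᶜ, g ω ∂P : ℝ) : EReal) ≤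
        integralFunctional P U (X + W) := by
      rw [← integral_indicator (hA n), ← integral_indicator (hA n).compl,
        ← integral_add (hai.indicator (hA n)) (hg.indicator (hA n).compl)]
      refine integral_le_expect ((hai.indicator (hA n)).add (hg.indicator (hA n).compl)) ?_
      filter_upwards [hgX, hX'] with ω h2 h3
      by_cases hω : ω ∈ A n
      · have h4 : (X + W) ω = z ω := by simp [hW, hω, h3]
        rw [h4, indicator_of_mem hω, indicator_of_notMem (by simpa using hω), add_zero]
        exact (hU.coe_toReal (hzU ω)).le
      · have h4 : (X + W) ω = X ω := by simp [hW, hω]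
        rw [h4, indicator_of_notMem hω, indicator_of_mem (by simpa using hω), zero_add]
        exact h2
    have h5 : (∫ ω in A n, (U (z ω)).toReal ∂P) + ∫ ω in (A n)ᶜ, g ω ∂P ≤ u + q W := by
      refine le_of_forall_lt_imp_le_of_dense fun c hc => ?_
      have := hq X hX (X + W) (add_mem_orlicz hU hN.zero (hsub hX) hWL) c
        ((EReal.coe_lt_coe_iff.2 hc).trans_le hmin)
      rwa [add_sub_cancel_left] at this
    linarith
  have hAμ := tendsto_measure_zero_of_absolutelyContinuous hμP hAP
  have hcompl : ∀ {ν : Measure Ω} {f : Ω → ℝ}, Integrable f ν →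
      Tendsto (fun n => ν (A n)ᶜ) atTop (𝓝 0) →
      Tendsto (fun n => ∫ ω in A n, f ω ∂ν) atTop (𝓝 (∫ ω, f ω ∂ν)) := by
    intro ν f hf hν
    have h1 := (hf.tendsto_setIntegral_nhds_zero hν).const_sub (∫ ω, f ω ∂ν)
    rw [sub_zero] at h1
    refine h1.congr fun n => ?_
    rw [← integral_add_compl (hA n) hf, add_sub_cancel_right]
  have hlim := le_of_tendsto_of_tendsto'
    ((hcompl hai hAP).add (hg.tendsto_setIntegral_nhds_zero hAP))
    (((hcompl (hzi.sub hX'i) hAμ).add tendsto_one_div_add_atTop_nhds_zero_nat).const_add u) key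
  have h6 : ∫ ω, X' ω ∂μ = ∫ ω, X ω ∂μ := (integral_congr_ae (hμP hX')).symm
  have h7 : ∫ ω, (z - X') ω ∂μ = ∫ ω, z ω ∂μ - ∫ ω, X ω ∂μ := by
    rw [integral_sub' hzi hX'i, h6]
  rw [h7] at hlim
  linarith

/-- Existence of a dual minimizer: the density of the countably additive part of a supergradient. -/
theorem exists_dual_bound (hU : IsUtility U) (hN : IsNormalized U) {𝒜 : Set (Ω → ℝ)}
    (hconv : Convex ℝ 𝒜) (hsub : 𝒜 ⊆ orlicz P (young U))
    (hcore : (𝒜 ∩ algCore P (young U) (utilDom P U)).Nonempty) {u : ℝ}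
    (hu : ∀ X ∈ 𝒜, integralFunctional P U X ≤ u) :
    ∃ Y ∈ orliczPos P (conjYoung U), ∀ X ∈ 𝒜 ∩ utilDom P U,
      integralFunctional P (dualUtility U) Y + ((∫ ω, X ω * Y ω ∂P : ℝ) : EReal) ≤ u := by
  obtain ⟨q, hq⟩ := exists_supergradient hU hN.zero hconv hsub hcore hu
  obtain ⟨X₀, hX₀⟩ : (𝒜 ∩ utilDom P U).Nonempty := by
    obtain ⟨X, hX, hXL, hXc⟩ := hcore
    obtain ⟨ε, hε, hε'⟩ := hXc X hXL
    have := hε' 0 le_rfl hε.le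
    exact ⟨X, hX, by simpa using this⟩
  have hpos := isPositiveOn_supergradient hU hN hsub ⟨X₀, hX₀⟩ hq
  obtain ⟨μ, hμfin, hμP, hμ, hμε⟩ := hpos.exists_regularPart
  set Y : Ω → ℝ := fun ω => (μ.rnDeriv P ω).toReal
  have hYm : Measurable Y := (Measure.measurable_rnDeriv μ P).ennreal_toReal
  have hY0 : ∀ ω, 0 ≤ Y ω := fun ω => ENNReal.toReal_nonneg
  have hint : ∀ W : Ω → ℝ, Integrable W μ → Integrable (fun ω => W ω * Y ω) P := fun W hW => by
    have := (integrable_rnDeriv_smul_iff hμP).2 hW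
    simpa [mul_comm] using this
  have hval : ∀ W : Ω → ℝ, ∫ ω, W ω * Y ω ∂P = ∫ ω, W ω ∂μ := fun W => by
    rw [← integral_rnDeriv_smul hμP]
    simp [Y, mul_comm]
  have habs : ∀ X ∈ 𝒜, Integrable X μ := fun X hX => by
    refine hpos.integrable hμP hμ (hsub hX).1 ?_
    exact mem_orlicz_of_abs_le hU hN.zero (hsub hX) (hsub hX).1.norm (ae_of_all _ fun ω => by simp)
  have hpay : ∀ X ∈ 𝒜 ∩ utilDom P U, ∀ n, Integrable (fun ω => bestPayoff U n (Y ω)) P ∧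
      ∫ ω, bestPayoff U n (Y ω) ∂P ≤ u - ∫ ω, X ω * Y ω ∂P := by
    intro X hX n
    obtain ⟨C, hC⟩ := exists_bound_bestResponse (U := U) n
    have hzm : Measurable fun ω => bestResponse U (Y ω) n :=
      (measurable_bestResponse hU n).comp hYm
    have hzi : Integrable (fun ω => bestResponse U (Y ω) n) μ :=
      Integrable.of_bound hzm.aestronglyMeasurable C
        (ae_of_all _ fun ω => by simpa using (hC (Y ω)).1)
    have hai : Integrable (fun ω => (U (bestResponse U (Y ω) n)).toReal) P :=
      Integrable.of_bound (hU.measurable.comp hzm).ereal_toReal.aestronglyMeasurable C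
        (ae_of_all _ fun ω => by simpa using (hC (Y ω)).2)
    refine ⟨hai.sub (hint _ hzi), ?_⟩
    have h1 := integral_utility_le_of_regularPart hU hN hsub hq hpos hμP hμ hμε hX.1 hX.2.2
      (habs X hX.1) hzm (fun ω => hC (Y ω)) (fun ω => utility_bestResponse_ne_bot hN.zero _ n)
    simp only [bestPayoff]
    rw [integral_sub hai (hint _ hzi), hval, hval]
    linarith
  have hbest0 : ∀ ω, bestPayoff U 0 (Y ω) = 0 := fun ω => by
    simp [bestPayoff, bestResponse, hN.zero]
  have hdual : ∀ X ∈ 𝒜 ∩ utilDom P U, integralFunctional P (dualUtility U) Y ≤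
      ((u - ∫ ω, X ω * Y ω ∂P : ℝ) : EReal) := by
    intro X hX
    have hnn : 0 ≤ u - ∫ ω, X ω * Y ω ∂P := by
      have := (hpay X hX 0).2
      simpa [hbest0] using this
    rw [integralFunctional, expect_of_nonneg fun ω => dualUtility_nonneg hN.zero _,
      ← max_eq_left hnn, ← EReal.coe_ennreal_ofReal, EReal.coe_ennreal_le_coe_ennreal_iff]
    calc ∫⁻ ω, (dualUtility U (Y ω)).toENNReal ∂P
        ≤ ∫⁻ ω, ⨆ n, ENNReal.ofReal (bestPayoff U n (Y ω)) ∂P := by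
          refine lintegral_mono fun ω => ?_
          have := EReal.toENNReal_le_toENNReal (dualUtility_le_iSup_bestPayoff hU (Y ω))
          rwa [EReal.toENNReal_coe] at this
      _ = ⨆ n, ∫⁻ ω, ENNReal.ofReal (bestPayoff U n (Y ω)) ∂P :=
          lintegral_iSup
            (fun n => ENNReal.measurable_ofReal.comp ((measurable_bestPayoff hU n).comp hYm))
            fun m n hmn ω => ENNReal.ofReal_le_ofReal (monotone_bestPayoff (Y ω) hmn)
      _ ≤ ENNReal.ofReal (u - ∫ ω, X ω * Y ω ∂P) := by
          refine iSup_le fun n => ?_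
          rw [← ofReal_integral_eq_lintegral_ofReal (hpay X hX n).1 (ae_of_all _ fun ω => ?_)]
          · exact ENNReal.ofReal_le_ofReal (hpay X hX n).2
          · have := monotone_bestPayoff (U := U) (Y ω) (Nat.zero_le n)
            simpa [hbest0] using this
  refine ⟨Y, ⟨⟨hYm.aestronglyMeasurable, 1, one_pos, ?_⟩, ae_of_all _ hY0⟩, fun X hX => ?_⟩
  · refine lt_of_le_of_lt (expect_mono (ae_of_all _ fun ω => ?_))
      ((hdual X₀ hX₀).trans_lt (EReal.coe_lt_top _))
    rw [one_mul]
    exact conjYoung_le_dualUtility hU (hY0 ω)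
  · refine (add_le_add_left (hdual X hX) _).trans (le_of_eq ?_)
    rw [← EReal.coe_add, sub_add_cancel]

end Attainment

/-! ### Invariance of the primal value under closures -/

section Closure

variable {Ω : Type*} [MeasurableSpace Ω] {P : Measure Ω} [IsProbabilityMeasure P] {U : ℝ → EReal}

/-- Near a point of the core, expected utility has a uniform lower bound: dilate the core point by
a factor `1 + ε` and use concavity. -/
lemma exists_minorant_of_mem_algCore (hU : IsUtility U) (h0 : U 0 = 0) {X : Ω → ℝ}
    (hX : X ∈ algCore P (young U) (utilDom P U)) :
    ∃ η > 0, ∃ c : ℝ, ∀ W ∈ orlicz P (young U), ∀ r : ℝ, 0 < r → r < η →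
      ∫⁻ ω, (young U (W ω / r)).toENNReal ∂P ≤ 1 →
      ∃ g : Ω → ℝ, Integrable g P ∧ (∀ᵐ ω ∂P, (g ω : EReal) ≤ U (X ω + W ω)) ∧
        c ≤ ∫ ω, g ω ∂P := by
  obtain ⟨ε, hε, hε'⟩ := hX.2 X hX.1
  obtain ⟨hL, hbot⟩ := hε' ε hε.le le_rfl
  obtain ⟨b, -, hb⟩ := EReal.lt_iff_exists_real_btwn.1 hbot
  obtain ⟨g, hg, hgX, -⟩ := exists_minorant hU hL.1 hb
  -- `X + W = (1 - θ) (1 + ε) X + θ (W / θ)`, and `U(W / θ) ≥ -Û(W / r)` for `r < θ`.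
  set θ := ε / (1 + ε)
  have hθ : 0 < θ := by positivity
  have hθ1 : 1 - θ = 1 / (1 + ε) := by simp only [θ]; field_simp; ring
  have hθ2 : 0 ≤ 1 - θ := by rw [hθ1]; positivity
  refine ⟨θ, hθ, (1 - θ) * (∫ ω, g ω ∂P) + θ * (-1), fun W hW r hr hrθ hW1 => ?_⟩
  have hm : AEMeasurable (fun ω => (young U (W ω / r)).toENNReal) P := by
    have := aemeasurable_young hU hW.1 r⁻¹
    simpa [div_eq_inv_mul] using this
  have hne : ∫⁻ ω, (young U (W ω / r)).toENNReal ∂P ≠ ⊤ := (hW1.trans_lt ENNReal.one_lt_top).ne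
  have hfin := ae_lt_top' hm hne
  have hhi : Integrable (fun ω => ((young U (W ω / r)).toENNReal).toReal) P :=
    integrable_toReal_of_lintegral_ne_top hm hne
  have hni : Integrable (fun ω => -((young U (W ω / r)).toENNReal).toReal) P := hhi.neg
  refine ⟨fun ω => (1 - θ) * g ω + θ * (-((young U (W ω / r)).toENNReal).toReal),
    (hg.const_mul _).add (hni.const_mul _), ?_, ?_⟩
  · filter_upwards [hgX, hfin] with ω h1 h2
    have h3 : ((-((young U (W ω / r)).toENNReal).toReal : ℝ) : EReal) ≤ U (W ω / θ) := by
      rw [EReal.coe_neg, EReal.coe_ennreal_toReal h2.ne, EReal.coe_toENNReal (young_nonneg hU h0 _),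
        young, neg_neg]
      refine hU.mono ((neg_le_neg ?_).trans (neg_abs_le _))
      rw [abs_div, abs_div (W ω) r, abs_of_pos hr, abs_of_pos hθ]
      gcongr
    have h4 := hU.coe_le_of_convexComb h1 h3 hθ2 hθ.le (by ring)
    refine h4.trans (le_of_eq (congrArg U ?_))
    rw [mul_div_cancel₀ _ hθ.ne', hθ1]
    field_simp
  · rw [integral_add (hg.const_mul _) (hni.const_mul _), integral_const_mul, integral_const_mul]
    have h5 : ∫ ω, ((young U (W ω / r)).toENNReal).toReal ∂P ≤ 1 := by
      rw [integral_toReal hm hfin]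
      exact ENNReal.toReal_le_of_le_ofReal zero_le_one (by simpa using hW1)
    have h6 : -1 ≤ ∫ ω, -((young U (W ω / r)).toENNReal).toReal ∂P := by
      rw [integral_neg]; linarith
    gcongr

lemma integralFunctional_le_of_mem_normClosure (hU : IsUtility U) (h0 : U 0 = 0)
    {𝒜 : Set (Ω → ℝ)} (hconv : Convex ℝ 𝒜) (hsub : 𝒜 ⊆ orlicz P (young U))
    (hcore : (𝒜 ∩ algCore P (young U) (utilDom P U)).Nonempty) {u : ℝ}
    (hu : ∀ X ∈ 𝒜, integralFunctional P U X ≤ u) {X : Ω → ℝ}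
    (hX : X ∈ normClosure P (young U) 𝒜) : integralFunctional P U X ≤ u := by
  obtain ⟨X₀, hX₀, hX₀c⟩ := hcore
  obtain ⟨η, hη, c₀, hc₀⟩ := exists_minorant_of_mem_algCore hU h0 hX₀c
  refine EReal.ge_of_forall_gt_iff_ge.1 fun c hc => ?_
  obtain ⟨g, hg, hgX, hcg⟩ := exists_minorant hU hX.1.1 hc
  have key : ∀ t : ℝ, 0 < t → t < 1 → (1 - t) * c + t * c₀ ≤ u := by
    intro t ht ht1
    have hs : 0 < (1 - t) / t := div_pos (by linarith) ht
    obtain ⟨Z, hZ, hZη⟩ := hX.2 (η / ((1 - t) / t)) (by positivity)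
    have hXZ : X - Z ∈ orlicz P (young U) := (orliczSpace P hU h0).sub_mem hX.1 (hsub hZ)
    obtain ⟨r, hr, hrη, hr1⟩ := exists_lintegral_young_div_le_one hU h0 hXZ hZη
    -- The convex combination `(1 - t) Z + t X₀` equals `(1 - t) X + t (X₀ + W)` with `W` small.
    obtain ⟨k, hk, hkX, hck⟩ := hc₀ (((1 - t) / t) • (Z - X))
      ((orliczSpace P hU h0).smul_mem _ ((orliczSpace P hU h0).sub_mem (hsub hZ) hX.1))
      ((1 - t) / t * r) (by positivity) (by rwa [lt_div_iff₀' hs] at hrη) (by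
        refine le_trans (le_of_eq (lintegral_congr fun ω => ?_)) hr1
        simp only [Pi.smul_apply, Pi.sub_apply, smul_eq_mul, young]
        rw [mul_div_mul_left _ _ hs.ne', abs_div, abs_sub_comm, ← abs_div])
    have hmem := hu _ (hconv hZ hX₀ (sub_nonneg.2 ht1.le) ht.le (sub_add_cancel 1 t))
    have hle := integral_le_expect (f := fun ω => U (((1 - t) • Z + t • X₀) ω))
      ((hg.const_mul (1 - t)).add (hk.const_mul t)) (by
        filter_upwards [hgX, hkX] with ω h1 h2
        refine (hU.coe_le_of_convexComb h1 h2 (sub_nonneg.2 ht1.le) ht.le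
          (sub_add_cancel 1 t)).trans (le_of_eq (congrArg U ?_))
        simp only [Pi.smul_apply, Pi.sub_apply, Pi.add_apply, smul_eq_mul]
        field_simp
        ring)
    have h3 := EReal.coe_le_coe_iff.1 (hle.trans hmem)
    rw [integral_add' (hg.const_mul _) (hk.const_mul _), integral_const_mul,
      integral_const_mul] at h3
    nlinarith
  rw [EReal.coe_le_coe_iff]
  have hlim : Tendsto (fun t : ℝ => (1 - t) * c + t * c₀) (𝓝[>] 0) (𝓝 c) := by
    have : Continuous fun t : ℝ => (1 - t) * c + t * c₀ := by fun_prop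
    have h := this.tendsto 0
    simp only [sub_zero, one_mul, zero_mul, add_zero] at h
    exact h.mono_left nhdsWithin_le_nhds
  refine le_of_tendsto hlim ?_
  filter_upwards [Ioo_mem_nhdsGT (one_pos (α := ℝ))] with t ht using key t ht.1 ht.2

/-- The duality theorem for an arbitrary convex set of positions that meets the core. -/
theorem duality_of_convex (hU : IsUtility U) (hN : IsNormalized U) {𝒜 : Set (Ω → ℝ)}
    (hconv : Convex ℝ 𝒜) (hsub : 𝒜 ⊆ orlicz P (young U))
    (hcore : (𝒜 ∩ algCore P (young U) (utilDom P U)).Nonempty) :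
    (⨆ X ∈ 𝒜, integralFunctional P U X) =
        (⨆ X ∈ normClosure P (young U) 𝒜, integralFunctional P U X) ∧
    (⨆ X ∈ 𝒜, integralFunctional P U X) = (⨆ X ∈ 𝒜 ∩ utilDom P U, integralFunctional P U X) ∧
    (⨆ X ∈ 𝒜, integralFunctional P U X) =
        (⨆ X ∈ weakClosure P (young U) (conjYoung U) (𝒜 ∩ utilDom P U),
          integralFunctional P U X) ∧
    IsLeast
      ((fun Y : Ω → ℝ => integralFunctional P (dualUtility U) Y +
          supportFun P (𝒜 ∩ utilDom P U) Y) '' orliczPos P (conjYoung U))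
      (⨆ X ∈ 𝒜, integralFunctional P U X) := by
  have h0 := hN.zero
  set u := ⨆ X ∈ 𝒜, integralFunctional P U X with hu_def
  have hle : ∀ X ∈ 𝒜, integralFunctional P U X ≤ u := fun X hX =>
    le_iSup₂ (f := fun X (_ : X ∈ 𝒜) => integralFunctional P U X) X hX
  have hdom : u = ⨆ X ∈ 𝒜 ∩ utilDom P U, integralFunctional P U X := by
    refine le_antisymm (iSup₂_le fun X hX => ?_) (iSup₂_le fun X hX => hle X hX.1)
    by_cases h : ⊥ < integralFunctional P U X
    · exact le_iSup₂ (f := fun X (_ : X ∈ 𝒜 ∩ utilDom P U) => integralFunctional P U X) X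
        ⟨hX, hsub hX, h⟩
    · rw [not_bot_lt_iff.1 h]
      exact bot_le
  obtain ⟨X₀, hX₀⟩ : (𝒜 ∩ utilDom P U).Nonempty := by
    obtain ⟨X, hX, hXL, hXc⟩ := hcore
    obtain ⟨ε, hε, hε'⟩ := hXc X hXL
    exact ⟨X, hX, by simpa using hε' 0 le_rfl hε.le⟩
  have hubot : u ≠ ⊥ := (hX₀.2.2.trans_le (hle X₀ hX₀.1)).ne'
  -- Weak duality on the weak closure, where the support function is the same.
  have hweak : ∀ Y ∈ orlicz P (conjYoung U),
      ∀ X ∈ weakClosure P (young U) (conjYoung U) (𝒜 ∩ utilDom P U),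
      integralFunctional P U X ≤ integralFunctional P (dualUtility U) Y +
        supportFun P (𝒜 ∩ utilDom P U) Y := by
    intro Y hY X hX
    refine (integralFunctional_le_add hU h0 hX.1 hY).trans (add_le_add_right ?_ _)
    refine EReal.ge_of_forall_gt_iff_ge.1 fun c hc => ?_
    rw [EReal.coe_lt_coe_iff] at hc
    obtain ⟨Z, hZ, hZX⟩ := hX.2 1 (fun _ => Y) (fun _ => hY) _ (sub_pos.2 hc)
    have h1 := (abs_lt.1 (hZX 0)).2
    calc (c : EReal) ≤ ((∫ ω, Z ω * Y ω ∂P : ℝ) : EReal) := EReal.coe_le_coe_iff.2 (by linarith)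
      _ ≤ supportFun P (𝒜 ∩ utilDom P U) Y :=
        le_iSup₂ (f := fun X (_ : X ∈ 𝒜 ∩ utilDom P U) => ((∫ ω, X ω * Y ω ∂P : ℝ) : EReal)) Z hZ
  have hsubweak : 𝒜 ∩ utilDom P U ⊆
      weakClosure P (young U) (conjYoung U) (𝒜 ∩ utilDom P U) := fun X hX =>
    ⟨hsub hX.1, fun n Y _ ε hε => ⟨X, hX, fun i => by simpa using hε⟩⟩
  have hlower : ∀ Y ∈ orlicz P (conjYoung U), u ≤ integralFunctional P (dualUtility U) Y +
      supportFun P (𝒜 ∩ utilDom P U) Y := fun Y hY => by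
    rw [hdom]
    exact iSup₂_le fun X hX => hweak Y hY X (hsubweak hX)
  obtain ⟨Y, hY, hYu⟩ : ∃ Y ∈ orliczPos P (conjYoung U), integralFunctional P (dualUtility U) Y +
      supportFun P (𝒜 ∩ utilDom P U) Y ≤ u := by
    rcases eq_or_ne u ⊤ with htop | htop
    · -- With an infinite primal value every `Y` is optimal.
      refine ⟨0, ⟨⟨aestronglyMeasurable_const, 1, one_pos, ?_⟩, ae_of_all _ fun _ => le_rfl⟩,
        htop ▸ le_top⟩
      have h1 : conjYoung U 0 = 0 := by
        refine le_antisymm (iSup_le fun x => ?_) (conjYoung_nonneg h0 0)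
        rw [mul_zero, EReal.coe_zero, zero_sub]
        simpa using EReal.neg_le_neg_iff.2 (young_nonneg hU h0 x)
      simp [h1, expect]
    · lift u to ℝ using ⟨htop, hubot⟩ with v
      obtain ⟨Y, hY, hYv⟩ := exists_dual_bound hU hN hconv hsub hcore hle
      refine ⟨Y, hY, ?_⟩
      have hnn : 0 ≤ integralFunctional P (dualUtility U) Y := by
        rw [integralFunctional, expect_of_nonneg fun ω => dualUtility_nonneg h0 _]
        exact EReal.coe_ennreal_nonneg _
      have hbot : integralFunctional P (dualUtility U) Y ≠ ⊥ := fun h => by simp [h] at hnn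
      have htop' : integralFunctional P (dualUtility U) Y ≠ ⊤ := fun h => by
        have := hYv X₀ hX₀
        rw [h, EReal.top_add_coe] at this
        exact absurd (top_le_iff.1 this) (EReal.coe_ne_top v)
      lift integralFunctional P (dualUtility U) Y to ℝ using ⟨htop', hbot⟩ with w
      have hsupp : supportFun P (𝒜 ∩ utilDom P U) Y ≤ ((v - w : ℝ) : EReal) :=
        iSup₂_le fun X hX => by
          have := hYv X hX
          rw [← EReal.coe_add, EReal.coe_le_coe_iff] at this
          exact EReal.coe_le_coe_iff.2 (by linarith)
      refine (add_le_add_right hsupp _).trans (le_of_eq ?_)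
      rw [← EReal.coe_add, add_sub_cancel]
  refine ⟨le_antisymm ?_ ?_, hdom, le_antisymm ?_ ?_, ⟨Y, hY, le_antisymm hYu (hlower Y hY.1)⟩, ?_⟩
  · refine iSup₂_le fun X hX => ?_
    refine le_iSup₂ (f := fun X (_ : X ∈ normClosure P (young U) 𝒜) => integralFunctional P U X) X
      ⟨hsub hX, fun ε hε => ⟨X, hX, ?_⟩⟩
    simp only [sub_self]
    rwa [gaugeNorm_zero h0]
  · refine iSup₂_le fun X hX => ?_
    rcases eq_or_ne u ⊤ with htop | htop
    · rw [htop]; exact le_top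
    · lift u to ℝ using ⟨htop, hubot⟩ with v
      exact integralFunctional_le_of_mem_normClosure hU h0 hconv hsub hcore hle hX
  · rw [hdom]
    exact biSup_mono fun X hX => hsubweak hX
  · exact iSup₂_le fun X hX => (hweak Y hY.1 X hX).trans hYu
  · rintro _ ⟨Z, hZ, rfl⟩
    exact hlower Z hZ.1

end Closure

end ExpUtility

end

theorem theorem2p1 {Ω : Type*} [mΩ : MeasurableSpace Ω] (P : Measure Ω) [IsProbabilityMeasure P]
    (ℱ : Filtration ℝ≥0 mΩ) (T : ℝ≥0) (hT : ℱ T = mΩ)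
    {d : ℕ} (S : ℝ≥0 → Ω → EuclideanSpace ℝ (Fin d))
    (hS : ExpUtility.IsSemimartingale ℱ P T S)
    (U : ℝ → EReal) (hU : ExpUtility.IsUtility U) (hU0 : ExpUtility.IsNormalized U)
    (B : Ω → ℝ) (hB : B ∈ ExpUtility.orlicz P (ExpUtility.young U))
    (𝒜 𝒟 : Set (Ω → ℝ))
    (h𝒜 : 𝒜 = ExpUtility.endowed ℱ P T S U B)
    (h𝒟 : 𝒟 = ExpUtility.utilDom P U)
    (hcore : (𝒜 ∩ ExpUtility.algCore P (ExpUtility.young U) 𝒟).Nonempty) :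
    (⨆ X ∈ 𝒜, ExpUtility.integralFunctional P U X) =
        (⨆ X ∈ ExpUtility.normClosure P (ExpUtility.young U) 𝒜,
          ExpUtility.integralFunctional P U X) ∧
    (⨆ X ∈ 𝒜, ExpUtility.integralFunctional P U X) =
        (⨆ X ∈ 𝒜 ∩ 𝒟, ExpUtility.integralFunctional P U X) ∧
    (⨆ X ∈ 𝒜, ExpUtility.integralFunctional P U X) =
        (⨆ X ∈ ExpUtility.weakClosure P (ExpUtility.young U) (ExpUtility.conjYoung U) (𝒜 ∩ 𝒟),
          ExpUtility.integralFunctional P U X) ∧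
    IsLeast
      ((fun Y : Ω → ℝ => ExpUtility.integralFunctional P (ExpUtility.dualUtility U) Y +
          ExpUtility.supportFun P (𝒜 ∩ 𝒟) Y) ''
        ExpUtility.orliczPos P (ExpUtility.conjYoung U))
      (⨆ X ∈ 𝒜, ExpUtility.integralFunctional P U X) := by
  subst h𝒜 h𝒟
  exact ExpUtility.duality_of_convex hU hU0 (ExpUtility.convex_endowed hS hU hU0.zero B)
    (ExpUtility.endowed_subset_orlicz hU hU0.zero hB) hcore
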